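/- Let $N\ge 1$, $\beta\in(0,1)$ and let $\vec a=(a_1<\dots<a_N)\in\mathbb Z^N$. Let $\mathbb W^N=\{\vec x\in\mathbb Z^N: x_1<\dots<x_N\}$, and for $\vec x\in\mathbb W^N$ put $|\vec x|=x_1+\dots+x_N$ and $\mathsf V(\vec x)=\prod_{1\le j<i\le N}(x_i-x_j)$. The noncolliding Bernoulli random walk with parameter $\beta$ started from $\vec a$ is the Markov chain $\vec X(t)$, $t\in\mathbb Z_{\ge 0}$, on $\mathbb W^N$ with $\vec X(0)=\vec a$ and transition probabilities $$\mathbb P\big(\vec X(t+1)=\vec x'\mid \vec X(t)=\vec x\big)=\frac{\mathsf V(\vec x')}{\mathsf V(\vec x)}\,\beta^{|\vec x'|-|\vec x|}(1-\beta)^{N-|\vec x'|+|\vec x|}$$ if $x_i'-x_i\in\{0,1\}$ for all $i$, and $0$ otherwise. Then $\vec X$ is dynamically determinantal: there is a kernel $K(t,x;s,y)$, with $t,s\in\mathbb Z_{\ge0}$ and $x,y\in\mathbb Z$, such that for all $k$ and all pairwise distinct space-time points $(t_1,y_1),\dots,(t_k,y_k)\in\mathbb Z_{\ge 0}\times\mathbb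 Z$, $$\mathbb P\big(y_i\in\{X_1(t_i),\dots,X_N(t_i)\}\text{ for all }i=1,\dots,k\big)=\det\big[K(t_\alpha,y_\alpha;t_\gamma,y_\gamma)\big]_{\alpha,\gamma=1}^k .$$ Moreover, for all $t_1,t_2\in\mathbb Z_{\ge1}$ and $x_1,x_2\in\mathbb Z$, $$K(t_1,x_1;t_2,x_2)=\mathbf 1_{x_1\ge x_2}\mathbf 1_{t_1>t_2}(-1)^{x_1-x_2+1}\binom{t_1-t_2}{x_1-x_2}$$ $$\qquad+\frac{t_1!}{(t_2-1)!}\frac1{(2\pi \mathrm i)^2}\int_{x_2-t_2+\frac12-\mathrm i\infty}^{x_2-t_2+\frac12+\mathrm i\infty}dz\oint dw\;\frac{(z-x_2+1)_{t_2-1}}{(w-x_1)_{t_1+1}}\,\frac1{w-z}\,\frac{\sin(\pi w)}{\sin(\pi z)}\Big(\frac{1-\beta}{\beta}\Big)^{w-z}\prod_{r=1}^N\frac{z-a_r}{w-a_r},$$ where $(u)_k=u(u+1)\cdots(u+k-1)$ and the integrals converge. Here $z$ runs upwards over the vertical line $\Re z=x_2-t_2+\frac12$, and the $w$ contour is any positively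 oriented circle, or union of two circles, with the following properties: each circle lies together with its interior strictly on one side of the $z$ line, with at most one circle on each side; no circle passes through an integer; and the circles together encircle all the $w$ poles $\{x_1-t_1,x_1-t_1+1,\dots,x_1\}\cap\{a_1,\dots,a_N\}$ of the integrand other than $w=z$. (If there are no such poles, the double integral is zero.) -/

import Mathlib

open MeasureTheory

namespace NoncollidingBernoulli

noncomputable section

/-- The Weyl chamber `x₁ < x₂ < … < x_N` in `ℤ^N`. -/
abbrev Weyl (N : ℕ) : Type := {x : Fin N → ℤ // StrictMono x}

/-- The Vandermonde product `∏_{j < i} (x_i - x_j)`. -/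
def vandermonde {N : ℕ} (x : Weyl N) : ℝ :=
  ∏ i : Fin N, ∏ j ∈ Finset.Iio i, ((x.1 i : ℝ) - (x.1 j : ℝ))

/-- `|x| = x₁ + … + x_N`. -/
def total {N : ℕ} (x : Weyl N) : ℤ := ∑ i, x.1 i

/-- One-step transition probabilities of the noncolliding Bernoulli random walk. -/
def transition {N : ℕ} (β : ℝ) (x x' : Weyl N) : ℝ :=
  if ∀ i, x'.1 i - x.1 i = 0 ∨ x'.1 i - x.1 i = 1 then
    vandermonde x' / vandermonde x *
      β ^ (total x' - total x) * (1 - β) ^ ((N : ℤ) - total x' + total x)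
  else 0

/-- `X` is a discrete time Markov chain on the Weyl chamber, started from `a`, whose one-step
transition probabilities are `transition β`. The Markov property is written without division:
`ℙ(X₀ = x₀, …, X_t = x_t, X_{t+1} = x') = ℙ(X₀ = x₀, …, X_t = x_t) · p(x_t, x')`. -/
structure IsWalk {N : ℕ} (β : ℝ) (a : Weyl N) {Ω : Type*} [MeasurableSpace Ω]
    (P : Measure Ω) (X : ℕ → Ω → Weyl N) : Prop where
  measurable : ∀ t, Measurable (X t)
  start : ∀ᵐ ω ∂P, X 0 ω = a
  markov : ∀ (t : ℕ) (x : ℕ → Weyl N) (x' : Weyl N),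
    P.real {ω | (∀ s ≤ t, X s ω = x s) ∧ X (t + 1) ω = x'} =
      P.real {ω | ∀ s ≤ t, X s ω = x s} * transition β (x t) x'

/-- The particle dynamics `X` is dynamically determinantal with space-time correlation kernel
`K(t, x; s, y)`. -/
def IsDeterminantal {N : ℕ} {Ω : Type*} [MeasurableSpace Ω] (P : Measure Ω)
    (X : ℕ → Ω → Weyl N) (K : ℕ → ℤ → ℕ → ℤ → ℂ) : Prop :=
  ∀ (k : ℕ) (t : Fin k → ℕ) (y : Fin k → ℤ),
    Function.Injective (fun i => (t i, y i)) →
    ((P.real {ω | ∀ i, ∃ j, (X (t i) ω).1 j = y i} : ℝ) : ℂ) =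
      Matrix.det (Matrix.of fun i j => K (t i) (y i) (t j) (y j))

/-- The Pochhammer symbol `(z)_k = z (z + 1) ⋯ (z + k - 1)`. -/
def poch (z : ℂ) (k : ℕ) : ℂ := (ascPochhammer ℂ k).eval z

/-- The integrand of the double contour integral. -/
def integrand {N : ℕ} (β : ℝ) (a : Weyl N) (t₁ : ℕ) (x₁ : ℤ) (t₂ : ℕ) (x₂ : ℤ)
    (z w : ℂ) : ℂ :=
  poch (z - x₂ + 1) (t₂ - 1) / poch (w - x₁) (t₁ + 1) *
    (1 / (w - z)) *
    (Complex.sin (Real.pi * w) / Complex.sin (Real.pi * z)) *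
    (((1 - β) / β : ℝ) : ℂ) ^ (w - z) *
    ∏ r : Fin N, (z - (a.1 r : ℂ)) / (w - (a.1 r : ℂ))

/-- The point with ordinate `u` on the vertical line `Re z = x₂ - t₂ + 1/2`. -/
def linePoint (t₂ : ℕ) (x₂ : ℤ) (u : ℝ) : ℂ :=
  ((x₂ : ℂ) - (t₂ : ℂ) + 1 / 2) + u * Complex.I

/-- The `w` poles `{x₁ - t₁, …, x₁} ∩ {a₁, …, a_N}` of the integrand, other than `w = z`. -/
def wPoles {N : ℕ} (a : Weyl N) (t₁ : ℕ) (x₁ : ℤ) : Set ℤ :=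
  Set.Icc (x₁ - t₁) x₁ ∩ Set.range a.1

/-- A pair of circles in the complex plane, given by centers and radii. -/
structure Circles where
  c₁ : ℂ
  r₁ : ℝ
  c₂ : ℂ
  r₂ : ℝ

/-- The two circles form an admissible `w` contour: the first one lies, with its interior, to the
left of the `z` line and the second one to the right of it, no circle passes through an integer
(where the integrand may be an indeterminate `0 / 0`), and together they encircle all the `w`
poles. A circle of radius `0` does not contribute to the integral, so that a single circle is
covered as well, when all the poles are on one side of the line. -/
structure Circles.Admissible (γ : Circles) {N : ℕ} (a : Weyl N)
    (t₁ : ℕ) (x₁ : ℤ) (t₂ : ℕ) (x₂ : ℤ) : Prop where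
  nonneg₁ : 0 ≤ γ.r₁
  nonneg₂ : 0 ≤ γ.r₂
  left : ∀ w ∈ Metric.closedBall γ.c₁ γ.r₁, w.re < (x₂ : ℝ) - t₂ + 1 / 2
  right : ∀ w ∈ Metric.closedBall γ.c₂ γ.r₂, (x₂ : ℝ) - t₂ + 1 / 2 < w.re
  avoids₁ : ∀ n : ℤ, (n : ℂ) ∉ Metric.sphere γ.c₁ γ.r₁
  avoids₂ : ∀ n : ℤ, (n : ℂ) ∉ Metric.sphere γ.c₂ γ.r₂
  encircles : ∀ s ∈ wPoles a t₁ x₁,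
    (s : ℂ) ∈ Metric.ball γ.c₁ γ.r₁ ∨ (s : ℂ) ∈ Metric.ball γ.c₂ γ.r₂

/-- The counter-clockwise contour integral over the union of the two circles. -/
def Circles.integral (γ : Circles) (f : ℂ → ℂ) : ℂ :=
  (∮ w in C(γ.c₁, γ.r₁), f w) + ∮ w in C(γ.c₂, γ.r₂), f w

/-- The double contour integral converges: for every `z` on the vertical line the integrand is
integrable in `w` over the circles, and the resulting function of `z` is integrable over
the line. -/
def Converges {N : ℕ} (β : ℝ) (a : Weyl N) (γ : Circles)
    (t₁ : ℕ) (x₁ : ℤ) (t₂ : ℕ) (x₂ : ℤ) : Prop :=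
  (∀ u : ℝ,
    CircleIntegrable (integrand β a t₁ x₁ t₂ x₂ (linePoint t₂ x₂ u)) γ.c₁ γ.r₁ ∧
    CircleIntegrable (integrand β a t₁ x₁ t₂ x₂ (linePoint t₂ x₂ u)) γ.c₂ γ.r₂) ∧
  Integrable fun u : ℝ =>
    γ.integral (integrand β a t₁ x₁ t₂ x₂ (linePoint t₂ x₂ u))

/-- The correlation kernel; `dz = i du` on the vertical line. -/
def kernel {N : ℕ} (β : ℝ) (a : Weyl N) (γ : Circles)
    (t₁ : ℕ) (x₁ : ℤ) (t₂ : ℕ) (x₂ : ℤ) : ℂ :=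
  (if x₂ ≤ x₁ ∧ t₂ < t₁ then
    (-1 : ℂ) ^ (x₁ - x₂ + 1) * ((t₁ - t₂).choose (x₁ - x₂).toNat : ℂ) else 0) +
  (t₁.factorial : ℂ) / ((t₂ - 1).factorial : ℂ) * (1 / (2 * Real.pi * Complex.I) ^ 2) *
    ∫ u : ℝ,
      γ.integral (integrand β a t₁ x₁ t₂ x₂ (linePoint t₂ x₂ u)) * Complex.I

end

end NoncollidingBernoulli

/-!
Let `avg β f x = (1 - β) f x + β f (x + 1)`. A family `q t j` with `avg β (q (t + 1) j) = q t j`,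
`q 0 j (a i) = δᵢⱼ` and `q t j` polynomial of degree less than `N` is dual to the Bernoulli weights
started from `a`. Averaging all coordinates of a determinant at once shows that
`x ↦ det [q t j (x i)]` is a multiple of the Vandermonde product at each time, and hence that the
conditional expectations of `∏ᵢ (1 + l 1{yᵢ ∈ X (tᵢ)})` remain quotients of a determinant of
one-particle functions by the Vandermonde product. Solving the one-particle recursion by Duhamel's
formula turns this generating function into a Fredholm determinant, whose top coefficient in `l` is
the determinant of the kernel
`∑ⱼ p_{t₁}(x₁ - aⱼ) q_{t₂ j}(x₂) - 1{t₂ < t₁} p_{t₁ - t₂}(x₁ - x₂)`.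

The dual family is explicit: `q (n + 1) j x` is the integral of
`(v + 1)_n / n! · Lⱼ(x + v) c ^ (-v) / sin (π v)` over the line `Re v = -n - 1/2`, up to a constant,
where `c = (1 - β) / β` and `Lⱼ` are the Lagrange polynomials at `a`. Averaging moves the line by
one unit, past a pole at which the residue is nonzero only for `n = 0`.

In the double contour integral `sin (π w) / (w - x₁)_{t₁ + 1}` is entire, and partial fractions of
`(w - z)⁻¹ ∏ (z - a_r) / (w - a_r)` leave only simple poles at the `aⱼ`, with coefficients `Lⱼ(z)`.
Cauchy's formula in `w` gives the kernel above up to conjugation by `(-c) ^ x / (1 - β) ^ t`.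
-/

namespace NoncollidingBernoulli

noncomputable section

section Averaging

variable {R : Type*} [CommRing R]

/-- The transition operator of a single Bernoulli walker: `avg β f x` is the expectation of
`f` after one step from `x`. -/
def avg (β : R) : (ℤ → R) →ₗ[R] (ℤ → R) :=
  (1 - β) • LinearMap.id + β • LinearMap.funLeft R R (· + 1)

lemma avg_apply (β : R) (f : ℤ → R) (x : ℤ) : avg β f x = (1 - β) * f x + β * f (x + 1) := rfl

/-- The probability that a single Bernoulli walker advances by `d` in `n` steps. -/
def bernoulliWeight (β : R) : ℕ → ℤ → R
  | 0, d => if d = 0 then 1 else 0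
  | n + 1, d => (1 - β) * bernoulliWeight β n d + β * bernoulliWeight β n (d - 1)

lemma avg_bernoulliWeight (β : R) (n : ℕ) (y : ℤ) :
    avg β (fun x => bernoulliWeight β n (y - x)) = fun x => bernoulliWeight β (n + 1) (y - x) := by
  ext x
  rw [avg_apply, bernoulliWeight, sub_sub]

/-- The configuration obtained from `x` when exactly the particles in `J` jump. -/
def jumpAt {ι : Type*} [DecidableEq ι] (J : Finset ι) (x : ι → ℤ) (i : ι) : ℤ :=
  if i ∈ J then x i + 1 else x i

lemma det_avg {ι : Type*} [Fintype ι] [DecidableEq ι] (β : R) (B : ι → ℤ → R) (x : ι → ℤ) :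
    Matrix.det (Matrix.of fun i j => avg β (B j) (x i)) =
      ∑ J : Finset ι, β ^ J.card * (1 - β) ^ Jᶜ.card *
        Matrix.det (Matrix.of fun i j => B j (jumpAt J x i)) := by
  have hrows : (Matrix.of fun i j => avg β (B j) (x i)) =
      (fun i => β • fun j => B j (x i + 1)) + fun i => (1 - β) • fun j => B j (x i) := by
    ext i j
    simp [avg_apply, add_comm]
  have hexpand := (Matrix.detRowAlternating (n := ι) (R := R)).toMultilinearMap.map_add_univ
    (fun i => β • fun j => B j (x i + 1)) (fun i => (1 - β) • fun j => B j (x i))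
  rw [hrows]
  refine hexpand.trans (Finset.sum_congr rfl fun J _ => ?_)
  have hpiece : J.piecewise (fun i => β • fun j => B j (x i + 1))
      (fun i => (1 - β) • fun j => B j (x i)) =
      fun i => J.piecewise (fun _ => β) (fun _ => 1 - β) i • fun j => B j (jumpAt J x i) := by
    ext i j
    by_cases hi : i ∈ J <;> simp [jumpAt, hi]
  have hweight : ∏ i, J.piecewise (fun _ => β) (fun _ => 1 - β) i =
      β ^ J.card * (1 - β) ^ Jᶜ.card := by
    rw [Finset.prod_piecewise, Finset.univ_inter, ← Finset.compl_eq_univ_sdiff,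
      Finset.prod_const, Finset.prod_const]
  rw [hpiece, ← hweight]
  exact (Matrix.detRowAlternating (n := ι) (R := R)).toMultilinearMap.map_smul_univ _ _

end Averaging

section Vandermonde

open Polynomial

variable {R : Type*} [CommRing R] {N : ℕ}

/-- The Vandermonde determinant of an integer vector, with values in `R`. -/
def vandermondeDet (R : Type*) [CommRing R] (x : Fin N → ℤ) : R :=
  (Matrix.vandermonde fun i => (x i : R)).det

lemma vandermondeDet_eq_vandermonde (x : Weyl N) : vandermondeDet ℂ x.1 = (vandermonde x : ℂ) := by
  rw [vandermondeDet, Matrix.det_vandermonde, vandermonde]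
  push_cast
  exact Finset.prod_comm' (by simp)

lemma vandermonde_pos (x : Weyl N) : 0 < vandermonde x :=
  Finset.prod_pos fun _ _ => Finset.prod_pos fun _ hj =>
    sub_pos.2 (Int.cast_lt.2 (x.2 (Finset.mem_Iio.1 hj)))

lemma exists_det_eval_eq_mul_vandermondeDet {p : Fin N → R[X]} (hp : ∀ j, (p j).degree < N) :
    ∃ κ : R, ∀ x : Fin N → ℤ,
      Matrix.det (Matrix.of fun i j => (p j).eval (x i : R)) = κ * vandermondeDet R x := by
  refine ⟨Matrix.det (Matrix.of fun (k : Fin N) j => (p j).coeff k), fun x => ?_⟩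
  rw [vandermondeDet, mul_comm, ← Matrix.det_mul]
  congr 1
  ext i j
  rw [Matrix.of_apply, eval_eq_sum,
    ← sum_fin (fun e c => c * (x i : R) ^ e) (fun _ => zero_mul _) (hp j), Matrix.mul_apply]
  simp only [Matrix.vandermonde_apply, Matrix.of_apply, mul_comm]

lemma sum_jumpAt_vandermondeDet (β : R) (x : Fin N → ℤ) :
    ∑ J : Finset (Fin N), β ^ J.card * (1 - β) ^ Jᶜ.card * vandermondeDet R (jumpAt J x) =
      vandermondeDet R x := by
  -- averaging a monic polynomial only changes its lower order coefficients
  nontriviality R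
  have hlt (j : ℕ) : (C β * ((X + C 1) ^ j - X ^ j)).degree < (X ^ j : R[X]).degree := by
    have hmonic : ((X + C 1 : R[X]) ^ j).Monic := (monic_X_add_C 1).pow j
    have hdeg : ((X + C 1 : R[X]) ^ j).degree = (X ^ j : R[X]).degree := by
      rw [degree_eq_natDegree hmonic.ne_zero, (monic_X_add_C 1).natDegree_pow, natDegree_X_add_C,
        mul_one, degree_X_pow]
    rw [← smul_eq_C_mul, ← hdeg]
    exact (degree_smul_le _ _).trans_lt
      (degree_sub_lt_left hdeg hmonic.ne_zero (hmonic.trans (monic_X_pow j).symm))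
  have havg := det_avg β (fun (j : Fin N) n => (n : R) ^ (j : ℕ)) x
  refine havg.symm.trans ?_
  rw [vandermondeDet, Matrix.det_eval_matrixOfPolynomials_eq_det_vandermonde _
    (fun j : Fin N => X ^ (j : ℕ) + C β * ((X + C 1) ^ (j : ℕ) - X ^ (j : ℕ)))]
  · congr 1
    ext i j
    simp [avg_apply]
    ring
  · intro j
    rw [natDegree_add_eq_left_of_degree_lt (hlt j), natDegree_X_pow]
  · exact fun j => (monic_X_pow (j : ℕ)).add_of_left (hlt j)

/-- Functions dual to the Bernoulli weights started from `a`: they are polynomials of degree less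
than `N` that are carried backwards in time by `avg`, and they interpolate the identity matrix on
`a` at time `0`. -/
structure IsDualFamily (β : R) (a : Fin N → ℤ) (q : ℕ → Fin N → ℤ → R) : Prop where
  avg_succ : ∀ t j, avg β (q (t + 1) j) = q t j
  apply_start : ∀ i j, q 0 j (a i) = (1 : Matrix (Fin N) (Fin N) R) i j
  exists_polynomial : ∀ t j, ∃ p : R[X], p.degree < N ∧ ∀ n : ℤ, q t j n = p.eval (n : R)

variable {β : R} {a : Fin N → ℤ} {q : ℕ → Fin N → ℤ → R}

lemma IsDualFamily.exists_det_eq_mul_vandermondeDet (hq : IsDualFamily β a q) (t : ℕ) :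
    ∃ κ : R, ∀ x : Fin N → ℤ,
      Matrix.det (Matrix.of fun i j => q t j (x i)) = κ * vandermondeDet R x := by
  choose p hdeg heval using hq.exists_polynomial t
  simpa only [heval] using exists_det_eval_eq_mul_vandermondeDet hdeg

lemma IsDualFamily.det_mul_vandermondeDet (hq : IsDualFamily β a q) (t : ℕ) (x : Fin N → ℤ) :
    Matrix.det (Matrix.of fun i j => q t j (x i)) * vandermondeDet R a = vandermondeDet R x := by
  induction t generalizing x with
  | zero =>
    obtain ⟨κ, hκ⟩ := hq.exists_det_eq_mul_vandermondeDet 0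
    have hone : Matrix.det (Matrix.of fun i j => q 0 j (a i)) = 1 := by
      simp only [hq.apply_start]
      exact Matrix.det_one
    rw [hκ, mul_right_comm, ← hκ, hone, one_mul]
  | succ t ih =>
    obtain ⟨κ, hκ⟩ := hq.exists_det_eq_mul_vandermondeDet (t + 1)
    have hback : Matrix.det (Matrix.of fun i j => q t j (x i)) = κ * vandermondeDet R x := by
      simp only [← hq.avg_succ t, det_avg, hκ, mul_left_comm _ κ, ← Finset.mul_sum,
        sum_jumpAt_vandermondeDet]
    rw [hκ, ← hback, ih]

end Vandermonde

section Fredholm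

variable {R : Type*} [CommRing R] {ι κ : Type*} [Fintype ι]

/-- The weight `1 + l` on the space-time points `(t i, y i)` and `1` elsewhere, at time `s` and
site `n`. -/
def siteWeight (t : ι → ℕ) (y : ι → ℤ) (l : R) (s : ℕ) (n : ℤ) : R :=
  1 + ∑ i, if t i = s ∧ y i = n then l else 0

lemma siteWeight_mul (β l : R) (t : ι → ℕ) (y : ι → ℤ) (s : ℕ) (f : ℤ → R) :
    siteWeight t y l s * f = f + ∑ i with t i = s,
      (l * f (y i)) • fun n => bernoulliWeight β (t i - s) (y i - n) := by
  ext n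
  rw [Pi.mul_apply, siteWeight, add_mul, one_mul, Finset.sum_mul, Pi.add_apply, Finset.sum_apply,
    Finset.sum_filter]
  congr 1
  refine Finset.sum_congr rfl fun i _ => ?_
  by_cases ht : t i = s <;> by_cases hy : y i = n <;>
    simp [ht, hy, bernoulliWeight, sub_eq_zero]

lemma siteWeight_mul_add_sum {β l : R} {t : ι → ℕ} {y : ι → ℤ} {s : ℕ} {f : ℤ → R}
    {g : ℕ → ℤ → R} (hg : g s = f + ∑ i with s < t i,
      (l * g (t i) (y i)) • fun n => bernoulliWeight β (t i - s) (y i - n)) :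
    siteWeight t y l s * g s = f + ∑ i with s ≤ t i,
      (l * g (t i) (y i)) • fun n => bernoulliWeight β (t i - s) (y i - n) := by
  classical
  have hsplit : ({i | s ≤ t i} : Finset ι) =
      ({i | s < t i} : Finset ι).disjUnion {i | t i = s}
        (Finset.disjoint_filter.2 fun _ _ h => h.ne') := by
    ext i
    simp only [Finset.mem_filter_univ, Finset.mem_disjUnion, le_iff_lt_or_eq, eq_comm]
  have hsite : ∑ i with t i = s,
        (l * g s (y i)) • (fun n => bernoulliWeight β (t i - s) (y i - n)) =
      ∑ i with t i = s,
        (l * g (t i) (y i)) • fun n => bernoulliWeight β (t i - s) (y i - n) :=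
    Finset.sum_congr rfl fun i hi => by rw [(Finset.mem_filter_univ i).1 hi]
  rw [siteWeight_mul β, hsite, hsplit, Finset.sum_disjUnion, ← add_assoc, ← hg]

lemma duhamel {β l : R} {t : ι → ℕ} {y : ι → ℤ} {T : ℕ} {f g : ℕ → ℤ → R}
    (hf : ∀ s, avg β (f (s + 1)) = f s) (ht : ∀ i, t i ≤ T) (hgT : g T = f T)
    (hg : ∀ s < T, g s = avg β (siteWeight t y l (s + 1) * g (s + 1))) {s : ℕ} (hs : s ≤ T) :
    g s = f s + ∑ i with s < t i,
      (l * g (t i) (y i)) • fun n => bernoulliWeight β (t i - s) (y i - n) := by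
  induction hs using Nat.decreasingInduction with
  | self =>
    rw [Finset.filter_false_of_mem fun i _ => (ht i).not_gt, Finset.sum_empty, add_zero, hgT]
  | of_succ s hs ih =>
    rw [hg s hs, siteWeight_mul_add_sum ih, map_add, hf, map_sum]
    congr 1
    refine Finset.sum_congr rfl fun i hi => ?_
    have hi : s + 1 ≤ t i := (Finset.mem_filter_univ i).1 hi
    rw [map_smul, avg_bernoulliWeight, ← Nat.sub_sub, Nat.sub_add_cancel (Nat.sub_pos_of_lt hi)]

lemma exists_backward_recursion {α : Type*} (F : ℕ → α → α) (T : ℕ) (z : α) :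
    ∃ u : ℕ → α, u T = z ∧ ∀ s < T, u s = F s (u (s + 1)) := by
  induction T generalizing z with
  | zero => exact ⟨fun _ => z, rfl, fun s hs => absurd hs s.not_lt_zero⟩
  | succ T ih =>
    obtain ⟨u, huT, hu⟩ := ih (F T z)
    refine ⟨Function.update u (T + 1) z, Function.update_self .., fun s hs => ?_⟩
    rw [Function.update_of_ne hs.ne]
    obtain hs | rfl := Nat.lt_succ_iff_lt_or_eq.1 hs
    · rw [Function.update_of_ne (Nat.succ_lt_succ hs).ne, hu s hs]
    · rw [Function.update_self, huT]

/-- The one-particle transition weights from the starting points to the space-time points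
`(t m, y m)`. -/
def startMatrix (β : R) (a : κ → ℤ) (t : ι → ℕ) (y : ι → ℤ) : Matrix κ ι R :=
  Matrix.of fun j m => bernoulliWeight β (t m) (y m - a j)

/-- The one-particle transition weights between space-time points at different times. -/
def hopMatrix (β : R) (t : ι → ℕ) (y : ι → ℤ) : Matrix ι ι R :=
  Matrix.of fun m i => if t m < t i then bernoulliWeight β (t i - t m) (y i - y m) else 0

/-- The values of the family `g` at the space-time points `(t m, y m)`. -/
def sampleMatrix (g : ℕ → κ → ℤ → R) (t : ι → ℕ) (y : ι → ℤ) : Matrix ι κ R :=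
  Matrix.of fun m j => g (t m) j (y m)

lemma sampleMatrix_eq_add_hopMatrix_mul {β l : R} {t : ι → ℕ} {y : ι → ℤ}
    {f g : ℕ → κ → ℤ → R}
    (hg : ∀ m j, g (t m) j = f (t m) j + ∑ i with t m < t i,
      (l * g (t i) j (y i)) • fun n => bernoulliWeight β (t i - t m) (y i - n)) :
    sampleMatrix g t y = sampleMatrix f t y + l • hopMatrix β t y * sampleMatrix g t y := by
  ext m j
  have h := congrFun (hg m j) (y m)
  rw [Pi.add_apply, Finset.sum_apply, Finset.sum_filter] at h
  rw [Matrix.add_apply, Matrix.mul_apply, sampleMatrix, Matrix.of_apply, h]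
  congr 1
  refine Finset.sum_congr rfl fun i _ => ?_
  simp only [hopMatrix, Matrix.smul_apply, Matrix.of_apply, Pi.smul_apply, smul_eq_mul]
  split_ifs
  · ring
  · simp

variable [Fintype κ]

/-- The space-time correlation kernel attached to a dual family `q`, before conjugation. -/
def preKernel (β : R) (a : κ → ℤ) (q : ℕ → κ → ℤ → R) (t₁ : ℕ) (x₁ : ℤ) (t₂ : ℕ) (x₂ : ℤ) : R :=
  (∑ j, bernoulliWeight β t₁ (x₁ - a j) * q t₂ j x₂) -
    if t₂ < t₁ then bernoulliWeight β (t₁ - t₂) (x₁ - x₂) else 0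

lemma of_preKernel {ι : Type*} (β : R) (a : κ → ℤ) (q : ℕ → κ → ℤ → R) (t : ι → ℕ) (y : ι → ℤ) :
    (Matrix.of fun i j => preKernel β a q (t i) (y i) (t j) (y j)) =
      (sampleMatrix q t y * startMatrix β a t y - hopMatrix β t y).transpose := by
  ext i j
  simp only [preKernel, Matrix.of_apply, Matrix.transpose_apply, Matrix.sub_apply,
    Matrix.mul_apply, sampleMatrix, startMatrix, hopMatrix, mul_comm (q _ _ _)]

variable [DecidableEq ι]

lemma det_one_sub_eq_one {α : Type*} [LinearOrder α] {t : ι → α} {Φ : Matrix ι ι R}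
    (hΦ : ∀ i j, t j ≤ t i → Φ i j = 0) : (1 - Φ).det = 1 := by
  have htriangular : (1 - Φ).BlockTriangular t := fun i j hij => by
    simp [hΦ i j hij.le, Matrix.one_apply_ne (ne_of_apply_ne t hij.ne')]
  rw [htriangular.det]
  refine Finset.prod_eq_one fun s _ => ?_
  have hblock : (1 - Φ).toSquareBlock t s = 1 := by
    ext i j
    simp [Matrix.toSquareBlock_def, hΦ i j (j.2.trans i.2.symm).le, Matrix.one_apply,
      Subtype.ext_iff]
  rw [hblock, Matrix.det_one]

variable [DecidableEq κ]

lemma det_one_add_mul_of_resolvent {Ψ : Matrix κ ι R} {S Q : Matrix ι κ R} {Φ : Matrix ι ι R}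
    (hΦ : (1 - Φ).det = 1) (hS : S = Q + Φ * S) :
    (1 + Ψ * S).det = (1 - Φ + Q * Ψ).det := by
  have hQ : (1 - Φ) * S = Q := by
    rw [Matrix.sub_mul, Matrix.one_mul, sub_eq_iff_eq_add, ← hS]
  calc (1 + Ψ * S).det = (1 - Φ).det * (1 + S * Ψ).det := by
        rw [hΦ, one_mul, Matrix.det_one_add_mul_comm]
    _ = (1 - Φ + Q * Ψ).det := by
        rw [← Matrix.det_mul, mul_add, mul_one, ← Matrix.mul_assoc, hQ]

lemma det_backward_eq_det_one_add_preKernel {β l : R} {a : κ → ℤ} {t : ι → ℕ} {y : ι → ℤ} {T : ℕ}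
    {q g : ℕ → κ → ℤ → R} (hstep : ∀ s j, avg β (q (s + 1) j) = q s j)
    (hstart : ∀ i j, q 0 j (a i) = (1 : Matrix κ κ R) i j) (ht : ∀ i, t i ≤ T) (hgT : g T = q T)
    (hg : ∀ s < T, ∀ j, g s j = avg β (siteWeight t y l (s + 1) * g (s + 1) j)) :
    Matrix.det (Matrix.of fun i j => siteWeight t y l 0 (a i) * g 0 j (a i)) =
      Matrix.det (1 + l • Matrix.of fun i j => preKernel β a q (t i) (y i) (t j) (y j)) := by
  have hduhamel (j : κ) {s : ℕ} (hs : s ≤ T) := duhamel (f := fun s => q s j)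
    (g := fun s => g s j) (fun s => hstep s j) ht (congrFun hgT j) (fun s hs => hg s hs j) hs
  have hresolvent := sampleMatrix_eq_add_hopMatrix_mul fun m j => hduhamel j (ht m)
  have hfactor : (Matrix.of fun i j => siteWeight t y l 0 (a i) * g 0 j (a i)) =
      1 + l • startMatrix β a t y * sampleMatrix g t y := by
    ext i j
    have h := congrFun (siteWeight_mul_add_sum (g := fun s => g s j) (hduhamel j T.zero_le)) (a i)
    simp only [Pi.mul_apply, Nat.zero_le, Finset.filter_true, Nat.sub_zero, Pi.add_apply,
      Finset.sum_apply, Pi.smul_apply, smul_eq_mul] at h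
    rw [Matrix.of_apply, h, hstart]
    simp only [startMatrix, sampleMatrix, Matrix.of_apply, Matrix.add_apply, Matrix.mul_apply,
      Matrix.smul_apply, smul_eq_mul, mul_right_comm, mul_assoc, mul_comm (g _ _ _)]
  have hdet : (1 - l • hopMatrix β t y).det = 1 := det_one_sub_eq_one (t := t) fun i j hij => by
    simp [hopMatrix, hij.not_gt]
  have hkernel : 1 - l • hopMatrix β t y + sampleMatrix q t y * (l • startMatrix β a t y) =
      1 + l • (sampleMatrix q t y * startMatrix β a t y - hopMatrix β t y) := by
    rw [Matrix.mul_smul, smul_sub]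
    abel
  rw [hfactor, det_one_add_mul_of_resolvent hdet hresolvent, hkernel, of_preKernel,
    ← Matrix.det_transpose, Matrix.transpose_add, Matrix.transpose_one, Matrix.transpose_smul]

end Fredholm

section Markov

variable {S Ω : Type*}

/-- The event that the process `X` follows the path `x` up to time `t`. -/
def history (X : ℕ → Ω → S) (t : ℕ) (x : ℕ → S) : Set Ω := {ω | ∀ s ≤ t, X s ω = x s}

lemma history_update (X : ℕ → Ω → S) (t : ℕ) (x : ℕ → S) (x' : S) :
    history X (t + 1) (Function.update x (t + 1) x') = history X t x ∩ X (t + 1) ⁻¹' {x'} := by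
  have hpast {s : ℕ} (hs : s ≤ t) : Function.update x (t + 1) x' s = x s :=
    Function.update_of_ne (Nat.lt_succ_of_le hs).ne _ _
  ext ω
  refine ⟨fun h => ⟨fun s hs => ?_, ?_⟩, fun h s hs => ?_⟩
  · rw [h s (Nat.le_succ_of_le hs), hpast hs]
  · exact (h (t + 1) le_rfl).trans (Function.update_self ..)
  · obtain hs | rfl := Nat.le_succ_iff.1 hs
    · rw [hpast hs]
      exact h.1 s hs
    · rw [Function.update_self]
      exact h.2

variable [MeasurableSpace S] [MeasurableSpace Ω]

/-- `X` is a discrete time Markov chain on the discrete space `S`, started from `a`, with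
transition probabilities `p`. As in `IsWalk`, the Markov property is written without division. -/
structure IsMarkovChain (p : S → S → ℝ) (a : S) (P : Measure Ω) (X : ℕ → Ω → S) : Prop where
  measurable : ∀ t, Measurable (X t)
  start : ∀ᵐ ω ∂P, X 0 ω = a
  markov : ∀ (t : ℕ) (x : ℕ → S) (x' : S),
    P.real (history X t x ∩ X (t + 1) ⁻¹' {x'}) = P.real (history X t x) * p (x t) x'

lemma IsWalk.isMarkovChain {N : ℕ} {β : ℝ} {a : Weyl N} {P : Measure Ω} {X : ℕ → Ω → Weyl N}
    (hX : IsWalk β a P X) : IsMarkovChain (transition β) a P X :=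
  ⟨hX.measurable, hX.start, hX.markov⟩

namespace IsMarkovChain

variable {p : S → S → ℝ} {a : S} {P : Measure Ω} {X : ℕ → Ω → S}
  {successors : S → Finset S}

lemma history_ae_eq_biUnion [Countable S] [IsFiniteMeasure P]
    (hX : IsMarkovChain p a P X) (hp : ∀ x, ∀ x' ∉ successors x, p x x' = 0) (t : ℕ) (x : ℕ → S) :
    history X t x =ᵐ[P] ⋃ x' ∈ successors (x t), history X t x ∩ X (t + 1) ⁻¹' {x'} := by
  have hnull : ∀ᵐ ω ∂P, ∀ x' ∉ successors (x t), ω ∉ history X t x ∩ X (t + 1) ⁻¹' {x'} := by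
    refine ae_all_iff.2 fun x' => ae_all_iff.2 fun hx' => ?_
    have hzero := hX.markov t x x'
    rw [hp _ _ hx', mul_zero, measureReal_eq_zero_iff] at hzero
    exact measure_eq_zero_iff_ae_notMem.1 hzero
  filter_upwards [hnull] with ω hω
  refine propext ⟨fun h => ?_, fun h => ?_⟩
  · refine Set.mem_biUnion (x := X (t + 1) ω) ?_ ⟨h, rfl⟩
    by_contra hc
    exact hω _ hc ⟨h, rfl⟩
  · obtain ⟨_, _, h⟩ := Set.mem_iUnion₂.1 h
    exact h.1

variable [DiscreteMeasurableSpace S]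

lemma measurableSet_history (hX : IsMarkovChain p a P X) (t : ℕ) (x : ℕ → S) :
    MeasurableSet (history X t x) := by
  have hInter : history X t x = ⋂ s ∈ Set.Iic t, X s ⁻¹' {x s} := by
    ext
    simp [history]
  rw [hInter]
  exact MeasurableSet.biInter (Set.to_countable _) fun s _ =>
    hX.measurable s (MeasurableSet.singleton _)

variable [IsFiniteMeasure P]

lemma integrable_prod (hX : IsMarkovChain p a P X) {g : ℕ → S → ℂ} {C : ℝ}
    (hg : ∀ s x, ‖g s x‖ ≤ C) (I : Finset ℕ) :
    Integrable (fun ω => ∏ s ∈ I, g s (X s ω)) P := by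
  refine Integrable.of_bound (C := C ^ I.card) ?_ (Filter.Eventually.of_forall fun ω => ?_)
  · exact (Finset.measurable_fun_prod I fun s _ =>
      (Measurable.of_discrete (f := g s)).comp (hX.measurable s)).aestronglyMeasurable
  · rw [norm_prod, ← Finset.prod_const]
    exact Finset.prod_le_prod (fun _ _ => norm_nonneg _) fun s _ => hg s _

variable [Countable S]

lemma setIntegral_history_eq_sum (hX : IsMarkovChain p a P X)
    (hp : ∀ x, ∀ x' ∉ successors x, p x x' = 0) (t : ℕ) (x : ℕ → S) {f : Ω → ℂ}
    (hf : Integrable f P) :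
    ∫ ω in history X t x, f ω ∂P = ∑ x' ∈ successors (x t),
      ∫ ω in history X (t + 1) (Function.update x (t + 1) x'), f ω ∂P := by
  simp only [setIntegral_congr_set (hX.history_ae_eq_biUnion hp t x), ← history_update]
  refine integral_biUnion_finset _ (fun x' _ => hX.measurableSet_history _ _) ?_
    fun _ _ => hf.integrableOn
  intro x' _ x'' _ hne
  simp only [Function.onFun, history_update]
  exact ((Set.disjoint_singleton.2 hne).preimage _).mono Set.inter_subset_right
    Set.inter_subset_right

variable {g w : ℕ → S → ℂ} {C : ℝ} {T : ℕ}

lemma setIntegral_history_prod (hX : IsMarkovChain p a P X)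
    (hp : ∀ x, ∀ x' ∉ successors x, p x x' = 0) (hg : ∀ s x, ‖g s x‖ ≤ C) (hwT : ∀ x, w T x = 1)
    (hw : ∀ s < T, ∀ x, w s x = ∑ x' ∈ successors x, (p x x' : ℂ) * (g (s + 1) x' * w (s + 1) x'))
    {t : ℕ} (ht : t ≤ T) (x : ℕ → S) :
    ∫ ω in history X t x, ∏ s ∈ Finset.Ioc t T, g s (X s ω) ∂P =
      (P.real (history X t x) : ℂ) * w t (x t) := by
  induction ht using Nat.decreasingInduction generalizing x with
  | self => simp [hwT]
  | of_succ t ht ih =>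
    rw [hX.setIntegral_history_eq_sum hp t x (hX.integrable_prod hg _), hw t ht, Finset.mul_sum]
    refine Finset.sum_congr rfl fun x' _ => ?_
    have hfirst : ∀ ω ∈ history X (t + 1) (Function.update x (t + 1) x'),
        ∏ s ∈ Finset.Ioc t T, g s (X s ω) =
          g (t + 1) x' * ∏ s ∈ Finset.Ioc (t + 1) T, g s (X s ω) := by
      intro ω hω
      rw [history_update] at hω
      rw [← Order.succ_eq_add_one, ← Finset.insert_Ioc_succ_left_eq_Ioc ht,
        Finset.prod_insert (by simp), Order.succ_eq_add_one, hω.2]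
    rw [setIntegral_congr_fun (hX.measurableSet_history _ _) hfirst, integral_const_mul, ih,
      Function.update_self, history_update, hX.markov]
    push_cast
    ring

lemma integral_prod [IsProbabilityMeasure P] (hX : IsMarkovChain p a P X)
    (hp : ∀ x, ∀ x' ∉ successors x, p x x' = 0) (hg : ∀ s x, ‖g s x‖ ≤ C) (hwT : ∀ x, w T x = 1)
    (hw : ∀ s < T, ∀ x, w s x =
      ∑ x' ∈ successors x, (p x x' : ℂ) * (g (s + 1) x' * w (s + 1) x')) :
    ∫ ω, ∏ s ∈ Finset.Icc 0 T, g s (X s ω) ∂P = g 0 a * w 0 a := by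
  have hstart : history X 0 (fun _ => a) =ᵐ[P] Set.univ := by
    filter_upwards [hX.start] with ω hω
    refine propext (iff_of_true (fun s hs => ?_) trivial)
    rwa [Nat.le_zero.1 hs]
  have hsplit : ∀ᵐ ω ∂P, ∏ s ∈ Finset.Icc 0 T, g s (X s ω) =
      g 0 a * ∏ s ∈ Finset.Ioc 0 T, g s (X s ω) := by
    filter_upwards [hX.start] with ω hω
    rw [← Finset.mul_prod_Ioc_eq_prod_Icc T.zero_le, hω]
  have hprod := hX.setIntegral_history_prod hp hg hwT hw T.zero_le fun _ => a
  rw [setIntegral_congr_set hstart, measureReal_congr hstart, setIntegral_univ, probReal_univ,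
    Complex.ofReal_one, one_mul] at hprod
  rw [integral_congr_ae hsplit, integral_const_mul, hprod]

end IsMarkovChain

end Markov

section Successors

variable {N : ℕ}

lemma jumpAt_injective {ι : Type*} [DecidableEq ι] (x : ι → ℤ) :
    Function.Injective fun J : Finset ι => jumpAt J x := by
  intro J K h
  ext i
  have hi := congrFun h i
  by_cases hJ : i ∈ J <;> by_cases hK : i ∈ K <;> simp_all [jumpAt]

lemma monotone_jumpAt (J : Finset (Fin N)) (x : Weyl N) : Monotone (jumpAt J x.1) := by
  refine monotone_iff_forall_lt.2 fun i j hij => ?_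
  have hx := x.2 hij
  unfold jumpAt
  split_ifs <;> lia

open Classical in
/-- The states that can be reached from `x` in one step. -/
def successors (x : Weyl N) : Finset (Weyl N) :=
  (Finset.univ.image fun J => jumpAt J x.1).subtype StrictMono

lemma mem_successors {x x' : Weyl N} : x' ∈ successors x ↔ ∃ J, jumpAt J x.1 = x'.1 := by
  simp [successors]

lemma transition_of_notMem_successors {β : ℝ} {x x' : Weyl N} (h : x' ∉ successors x) :
    transition β x x' = 0 := by
  refine if_neg fun hstep => h (mem_successors.2
    ⟨({i | x'.1 i - x.1 i = 1} : Finset (Fin N)), funext fun i => ?_⟩)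
  have hi := hstep i
  simp only [jumpAt, Finset.mem_filter_univ]
  split_ifs <;> lia

lemma transition_of_jumpAt {β : ℝ} {x x' : Weyl N} {J : Finset (Fin N)}
    (h : jumpAt J x.1 = x'.1) :
    transition β x x' = vandermonde x' / vandermonde x * β ^ J.card * (1 - β) ^ Jᶜ.card := by
  have hsub (i : Fin N) : x'.1 i - x.1 i = if i ∈ J then 1 else 0 := by
    rw [← h, jumpAt]
    split_ifs <;> ring
  have hcard : total x' - total x = J.card := by
    simp [total, ← Finset.sum_sub_distrib, hsub]
  have hcompl : (N : ℤ) - total x' + total x = Jᶜ.card := by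
    have hadd := J.card_add_card_compl
    rw [Fintype.card_fin] at hadd
    lia
  rw [transition, if_pos fun i => ?_, hcard, hcompl, zpow_natCast, zpow_natCast]
  rw [hsub]
  split_ifs <;> simp

lemma sum_transition_mul_det (β : ℝ) (x : Weyl N) (B : Fin N → ℤ → ℂ) :
    ∑ x' ∈ successors x, (transition β x x' : ℂ) *
        (Matrix.det (Matrix.of fun i j => B j (x'.1 i)) / vandermonde x') =
      Matrix.det (Matrix.of fun i j => avg (β : ℂ) (B j) (x.1 i)) / vandermonde x := by
  classical
  have hcollision : ∀ J : Finset (Fin N), ¬ StrictMono (jumpAt J x.1) →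
      Matrix.det (Matrix.of fun i j => B j (jumpAt J x.1 i)) = 0 := by
    intro J hJ
    obtain ⟨i, j, heq, hne⟩ := Function.not_injective_iff.1
      fun hinj => hJ ((monotone_jumpAt J x).strictMono_of_injective hinj)
    exact Matrix.det_zero_of_row_eq hne (funext fun k => congrArg (B k) heq)
  rw [det_avg, Finset.sum_div, ← Finset.sum_filter_of_ne (p := fun J => StrictMono (jumpAt J x.1))]
  · symm
    refine Finset.sum_bij (fun J hJ => ⟨jumpAt J x.1, (Finset.mem_filter_univ J).1 hJ⟩)
      (fun J _ => mem_successors.2 ⟨J, rfl⟩)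
      (fun J _ K _ h => jumpAt_injective x.1 (Subtype.ext_iff.1 h)) (fun x' hx' => ?_)
      fun J hJ => ?_
    · obtain ⟨J, hJ⟩ := mem_successors.1 hx'
      exact ⟨J, (Finset.mem_filter_univ J).2 (hJ ▸ x'.2), Subtype.ext hJ⟩
    · set x' : Weyl N := ⟨jumpAt J x.1, (Finset.mem_filter_univ J).1 hJ⟩
      have hV' : (vandermonde x' : ℂ) ≠ 0 := mod_cast (vandermonde_pos x').ne'
      rw [transition_of_jumpAt (x' := x') rfl]
      push_cast
      field_simp
      simp [x']
  · intro J _ hne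
    by_contra hJ
    rw [hcollision J hJ, mul_zero, zero_div] at hne
    exact hne rfl

end Successors

section Occupation

variable {ι κ : Type*} [Fintype ι] [Fintype κ] {R : Type*} [CommRing R]

lemma siteWeight_eq_prod {t : ι → ℕ} {y : ι → ℤ} (hty : Function.Injective fun i => (t i, y i))
    (l : R) (s : ℕ) (n : ℤ) :
    siteWeight t y l s n = ∏ i, if t i = s then if y i = n then 1 + l else 1 else 1 := by
  simp only [← ite_and]
  by_cases h : ∃ i, t i = s ∧ y i = n
  · obtain ⟨i, hi⟩ := h
    have hne : ∀ m ≠ i, ¬ (t m = s ∧ y m = n) := fun m hm hc =>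
      hm (hty (Prod.ext (hc.1.trans hi.1.symm) (hc.2.trans hi.2.symm)))
    rw [siteWeight, Fintype.sum_eq_single i fun m hm => if_neg (hne m hm),
      Fintype.prod_eq_single i fun m hm => if_neg (hne m hm), if_pos hi, if_pos hi]
  · have hne : ∀ i, ¬ (t i = s ∧ y i = n) := fun i hi => h ⟨i, hi⟩
    simp [siteWeight, hne]

open Classical in
lemma prod_siteWeight {t : ι → ℕ} {y : ι → ℤ} {T : ℕ}
    (hty : Function.Injective fun i => (t i, y i)) (ht : ∀ i, t i ≤ T) (l : R)
    {x : ℕ → κ → ℤ} (hx : ∀ s, Function.Injective (x s)) :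
    ∏ s ∈ Finset.Icc 0 T, ∏ j, siteWeight t y l s (x s j) =
      ∏ i, if ∃ j, x (t i) j = y i then 1 + l else 1 := by
  have hsite (i : ι) : ∏ s ∈ Finset.Icc 0 T, ∏ j,
      (if t i = s then if y i = x s j then 1 + l else 1 else 1) =
        if ∃ j, x (t i) j = y i then 1 + l else 1 := by
    have htime (s : ℕ) : ∏ j, (if t i = s then if y i = x s j then 1 + l else 1 else 1) =
        if t i = s then ∏ j, if y i = x s j then 1 + l else 1 else 1 := by
      split_ifs <;> simp
    rw [Finset.prod_congr rfl fun s _ => htime s, Finset.prod_ite_eq,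
      if_pos (Finset.mem_Icc.2 ⟨(t i).zero_le, ht i⟩)]
    by_cases h : ∃ j, x (t i) j = y i
    · obtain ⟨j, hj⟩ := h
      rw [if_pos ⟨j, hj⟩, Fintype.prod_eq_single j fun m hm => ?_, if_pos hj.symm]
      exact if_neg fun hm' => hm (hx (t i) (hm'.symm.trans hj.symm))
    · rw [if_neg h]
      exact Finset.prod_eq_one fun j _ => if_neg fun hj => h ⟨j, hj.symm⟩
  simp only [siteWeight_eq_prod hty]
  rw [Finset.prod_congr rfl fun s _ => Finset.prod_comm, Finset.prod_comm]
  exact Finset.prod_congr rfl fun i _ => hsite i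

lemma norm_siteWeight_le (t : ι → ℕ) (y : ι → ℤ) (l : ℂ) (s : ℕ) (n : ℤ) :
    ‖siteWeight t y l s n‖ ≤ 1 + Fintype.card ι * ‖l‖ := by
  refine (norm_add_le _ _).trans (add_le_add norm_one.le ?_)
  refine (norm_sum_le_of_le (f := fun i => if t i = s ∧ y i = n then l else 0)
    (n := fun _ => ‖l‖) _ fun i _ => ?_).trans_eq (by simp)
  split_ifs <;> simp

lemma det_siteWeight_mul [DecidableEq κ] (t : ι → ℕ) (y : ι → ℤ) (l : R) (s : ℕ)
    (g : κ → ℤ → R) (x : κ → ℤ) :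
    Matrix.det (Matrix.of fun i j => (siteWeight t y l s * g j) (x i)) =
      (∏ i, siteWeight t y l s (x i)) * Matrix.det (Matrix.of fun i j => g j (x i)) :=
  Matrix.det_mul_column (fun i => siteWeight t y l s (x i)) (Matrix.of fun i j => g j (x i))

end Occupation

section GeneratingFunction

lemma prod_indicator_one {ι Ω : Type*} {s : ι → Set Ω} (I : Finset ι) (ω : Ω) :
    ∏ i ∈ I, (s i).indicator (1 : Ω → ℂ) ω = (⋂ i ∈ I, s i).indicator 1 ω := by
  classical
  simp [Set.indicator_apply, Finset.prod_ite_zero]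

variable {ι Ω : Type*} [Fintype ι] [MeasurableSpace Ω] {P : Measure Ω} {f : ι → Ω → ℂ}

lemma continuous_integral_prod_add
    (hf : ∀ I : Finset ι, Integrable (fun ω => ∏ i ∈ I, f i ω) P) :
    Continuous fun μ : ℂ => ∫ ω, ∏ i, (μ + f i ω) ∂P := by
  classical
  have hexpand (μ : ℂ) : ∫ ω, ∏ i, (μ + f i ω) ∂P =
      ∑ I ∈ Finset.univ.powerset, μ ^ I.card * ∫ ω, ∏ i ∈ Finset.univ \ I, f i ω ∂P := by
    simp only [Finset.prod_add, Finset.prod_const]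
    rw [integral_finsetSum _ fun I _ => (hf _).const_mul _]
    simp only [integral_const_mul]
  simp only [hexpand]
  fun_prop

lemma integral_prod_eq_det_of_generating [DecidableEq ι] {M : Matrix ι ι ℂ}
    (hf : ∀ I : Finset ι, Integrable (fun ω => ∏ i ∈ I, f i ω) P)
    (hgen : ∀ l : ℂ, ∫ ω, ∏ i, (1 + l * f i ω) ∂P = (1 + l • M).det) :
    ∫ ω, ∏ i, f i ω ∂P = M.det := by
  -- homogenize with `l = μ⁻¹` and let `μ → 0`
  have hhom : ∀ μ ∈ ({0}ᶜ : Set ℂ), ∫ ω, ∏ i, (μ + f i ω) ∂P = (μ • 1 + M).det := by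
    intro μ hμ
    have hμ : μ ≠ 0 := hμ
    calc ∫ ω, ∏ i, (μ + f i ω) ∂P
        = ∫ ω, μ ^ Fintype.card ι * ∏ i, (1 + μ⁻¹ * f i ω) ∂P := by
          refine integral_congr_ae (Filter.Eventually.of_forall fun ω => ?_)
          beta_reduce
          rw [← Finset.card_univ, ← Finset.prod_const, ← Finset.prod_mul_distrib]
          exact Finset.prod_congr rfl fun i _ => by field_simp
      _ = (μ • (1 + μ⁻¹ • M)).det := by rw [integral_const_mul, hgen, Matrix.det_smul]
      _ = (μ • 1 + M).det := by rw [smul_add, smul_inv_smul₀ hμ]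
  have heq := Continuous.ext_on (dense_compl_singleton (0 : ℂ)) (continuous_integral_prod_add hf)
    (g := fun μ => (μ • 1 + M).det) (by fun_prop) hhom
  simpa using congrFun heq 0

end GeneratingFunction

section Correlations

variable {N : ℕ} {β : ℝ} {a : Weyl N} {Ω : Type*} [MeasurableSpace Ω] {P : Measure Ω}
  [IsProbabilityMeasure P] {X : ℕ → Ω → Weyl N} {ι : Type*} [Fintype ι]
  {q : ℕ → Fin N → ℤ → ℂ}

/-- The event that a particle sits at `n` at time `t`. -/
def occupied (X : ℕ → Ω → Weyl N) (t : ℕ) (n : ℤ) : Set Ω := {ω | ∃ j, (X t ω).1 j = n}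

omit [IsProbabilityMeasure P] in
lemma IsWalk.measurableSet_occupied (hX : IsWalk β a P X) (t : ℕ) (n : ℤ) :
    MeasurableSet (occupied X t n) :=
  hX.measurable t (MeasurableSet.of_discrete (s := {x : Weyl N | ∃ j, x.1 j = n}))

lemma integral_prod_occupied [DecidableEq ι] (hX : IsWalk β a P X)
    (hq : IsDualFamily (β : ℂ) a.1 q) {t : ι → ℕ} {y : ι → ℤ}
    (hty : Function.Injective fun i => (t i, y i)) (l : ℂ) :
    ∫ ω, ∏ i, (1 + l * (occupied X (t i) (y i)).indicator 1 ω) ∂P =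
      Matrix.det (1 + l • Matrix.of fun i j =>
        preKernel (β : ℂ) a.1 q (t i) (y i) (t j) (y j)) := by
  classical
  have ht : ∀ i, t i ≤ ∑ i, t i := fun i =>
    Finset.single_le_sum (fun _ _ => Nat.zero_le _) (Finset.mem_univ i)
  obtain ⟨g, hgT, hg⟩ := exists_backward_recursion
    (fun s (f : Fin N → ℤ → ℂ) j => avg (β : ℂ) (siteWeight t y l (s + 1) * f j)) (∑ i, t i)
    (q (∑ i, t i))
  have hV (x : Weyl N) : (vandermonde x : ℂ) ≠ 0 := mod_cast (vandermonde_pos x).ne'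
  have hoccupied (ω : Ω) : ∏ i, (1 + l * (occupied X (t i) (y i)).indicator 1 ω) =
      ∏ s ∈ Finset.Icc 0 (∑ i, t i), ∏ j, siteWeight t y l s ((X s ω).1 j) := by
    rw [prod_siteWeight hty ht l fun s => (X s ω).2.injective]
    refine Finset.prod_congr rfl fun i _ => ?_
    by_cases h : ∃ j, (X (t i) ω).1 j = y i <;> simp [occupied, h]
  simp only [hoccupied]
  rw [hX.isMarkovChain.integral_prod (successors := successors)
    (g := fun s x => ∏ i, siteWeight t y l s (x.1 i))
    (w := fun s x => Matrix.det (Matrix.of fun i j => g s j (x.1 i)) * vandermonde a /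
      vandermonde x)
    (C := (1 + Fintype.card ι * ‖l‖) ^ N) (fun x x' => transition_of_notMem_successors)
    (fun s x => ?bound) (fun x => ?terminal) (fun s hs x => ?step)]
  · rw [← det_backward_eq_det_one_add_preKernel hq.avg_succ hq.apply_start ht hgT
      (fun s hs j => congrFun (hg s hs) j), mul_div_cancel_right₀ _ (hV a)]
    exact (det_siteWeight_mul t y l 0 (g 0) a.1).symm
  case bound =>
    rw [norm_prod]
    exact (Finset.prod_le_prod (fun _ _ => norm_nonneg _) fun i _ =>
      norm_siteWeight_le t y l s (x.1 i)).trans_eq (by simp)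
  case terminal =>
    rw [hgT, ← vandermondeDet_eq_vandermonde, hq.det_mul_vandermondeDet,
      vandermondeDet_eq_vandermonde, div_self (hV x)]
  case step =>
    rw [hg s hs, mul_div_right_comm, ← sum_transition_mul_det, Finset.sum_mul]
    refine Finset.sum_congr rfl fun x' _ => ?_
    rw [det_siteWeight_mul]
    ring

theorem IsWalk.isDeterminantal_preKernel (hX : IsWalk β a P X)
    (hq : IsDualFamily (β : ℂ) a.1 q) : IsDeterminantal P X (preKernel (β : ℂ) a.1 q) := by
  intro k t y hty
  have hevent : {ω | ∀ i, ∃ j, (X (t i) ω).1 j = y i} = ⋂ i, occupied X (t i) (y i) := by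
    ext
    simp [occupied]
  have hmeas (I : Finset (Fin k)) : MeasurableSet (⋂ i ∈ I, occupied X (t i) (y i)) :=
    I.measurableSet_biInter fun i _ => hX.measurableSet_occupied (t i) (y i)
  rw [← integral_prod_eq_det_of_generating (f := fun i => (occupied X (t i) (y i)).indicator 1)
    (fun I => ?_) (integral_prod_occupied hX hq hty)]
  · simp only [prod_indicator_one]
    refine .trans ?_ (integral_indicator_const (1 : ℂ) (hmeas Finset.univ)).symm
    simp [hevent]
  · simp only [prod_indicator_one]
    exact (integrable_const (1 : ℂ)).indicator (hmeas I)

end Correlations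

section VerticalLines

open Filter Topology
open Complex (I)

lemma integral_vertical_line_eq {E : Type*} [NormedAddCommGroup E] [NormedSpace ℂ E]
    [CompleteSpace E] {F : ℂ → E} {a b : ℝ} {φ : ℝ → ℝ}
    (hF : DifferentiableOn ℂ F (Complex.re ⁻¹' Set.uIcc a b))
    (ha : Integrable fun y : ℝ => F (a + y * I)) (hb : Integrable fun y : ℝ => F (b + y * I))
    (hφ : Tendsto φ (cocompact ℝ) (𝓝 0))
    (hle : ∀ᶠ y : ℝ in cocompact ℝ, ∀ x ∈ Set.uIcc a b, ‖F (x + y * I)‖ ≤ φ y) :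
    ∫ y : ℝ, F (a + y * I) = ∫ y : ℝ, F (b + y * I) := by
  have hhor : Tendsto (fun y : ℝ => ∫ x in a..b, F (x + y * I)) (cocompact ℝ) (𝓝 0) := by
    refine squeeze_zero_norm' ?_ (by simpa using hφ.mul_const |b - a|)
    filter_upwards [hle] with y hy
    exact intervalIntegral.norm_integral_le_of_norm_le_const fun x hx =>
      hy x (Set.uIoc_subset_uIcc hx)
  rw [cocompact_eq_atBot_atTop, tendsto_sup] at hhor
  have hlim := (((hhor.1.comp tendsto_neg_atTop_atBot).sub hhor.2).add
    ((intervalIntegral_tendsto_integral hb tendsto_neg_atTop_atBot tendsto_id).const_smul I)).sub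
    ((intervalIntegral_tendsto_integral ha tendsto_neg_atTop_atBot tendsto_id).const_smul I)
  have hrect (T : ℝ) := Complex.integral_boundary_rect_eq_zero_of_differentiableOn F
    ⟨a, -T⟩ ⟨b, T⟩ (hF.mono Set.inter_subset_left)
  have hzero := tendsto_nhds_unique hlim (tendsto_const_nhds.congr fun T => (hrect T).symm)
  rw [sub_zero, zero_add, ← smul_sub, smul_eq_zero_iff_right Complex.I_ne_zero, sub_eq_zero]
    at hzero
  exact hzero.symm

/-- Entire functions that grow at most like `exp |Im z|` in every vertical strip, so that dividing
by `sin (π z)` makes them integrable along vertical lines. -/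
structure Tame (h : ℂ → ℂ) : Prop where
  differentiable : Differentiable ℂ h
  bound : ∀ b : ℝ, ∃ C : ℝ, ∀ z : ℂ, |z.re| ≤ b → ‖h z‖ ≤ C * Real.exp |z.im|

/-- The integral over the vertical line `Re z = σ` against the density `1 / (2 cosh (π u))`, which
is `± 1 / (2 sin (π z))` when `σ` is half an odd integer. -/
def lineIntegral (h : ℂ → ℂ) (σ : ℝ) : ℂ :=
  ∫ u : ℝ, h (σ + u * I) / (2 * Complex.cosh (Real.pi * u))

lemma lineIntegral_comp_add (h : ℂ → ℂ) (m σ : ℝ) :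
    lineIntegral (fun z => h (z + m)) σ = lineIntegral h (σ + m) := by
  simp only [lineIntegral, Complex.ofReal_add, add_right_comm]

lemma lineIntegral_const_mul (h : ℂ → ℂ) (d : ℂ) (σ : ℝ) :
    lineIntegral (fun z => d * h z) σ = d * lineIntegral h σ := by
  simp only [lineIntegral, mul_div_assoc, integral_const_mul]

lemma tame_const (d : ℂ) : Tame fun _ => d where
  differentiable := differentiable_const d
  bound _ := ⟨‖d‖, fun _ _ => le_mul_of_one_le_right (norm_nonneg d)
    (Real.one_le_exp (abs_nonneg _))⟩

namespace Tame

variable {h g : ℂ → ℂ}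

lemma comp_add (hh : Tame h) (m : ℝ) : Tame fun z => h (z + m) where
  differentiable := hh.differentiable.comp (by fun_prop)
  bound b := by
    obtain ⟨C, hC⟩ := hh.bound (b + |m|)
    refine ⟨C, fun z hz => ?_⟩
    have hre : |(z + m).re| ≤ b + |m| := (abs_add_le _ _).trans (by simpa using hz)
    simpa using hC (z + m) hre

lemma const_mul (hh : Tame h) (d : ℂ) : Tame fun z => d * h z where
  differentiable := hh.differentiable.const_mul d
  bound b := by
    obtain ⟨C, hC⟩ := hh.bound b
    refine ⟨‖d‖ * C, fun z hz => ?_⟩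
    rw [norm_mul, mul_assoc]
    exact mul_le_mul_of_nonneg_left (hC z hz) (norm_nonneg _)

lemma sub (hh : Tame h) (hg : Tame g) : Tame fun z => h z - g z where
  differentiable := hh.differentiable.sub hg.differentiable
  bound b := by
    obtain ⟨C, hC⟩ := hh.bound b
    obtain ⟨D, hD⟩ := hg.bound b
    refine ⟨C + D, fun z hz => (norm_sub_le _ _).trans ?_⟩
    rw [add_mul]
    exact add_le_add (hC z hz) (hD z hz)

end Tame

lemma integrable_exp_neg_abs : Integrable fun u : ℝ => Real.exp (-|u|) := by
  refine (integrable_inv_one_add_sq.const_mul 2).mono' (by fun_prop)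
    (Eventually.of_forall fun u => ?_)
  have hexp := Real.quadratic_le_exp_of_nonneg (abs_nonneg u)
  rw [Real.norm_of_nonneg (Real.exp_nonneg _), Real.exp_neg, ← div_eq_mul_inv,
    inv_le_comm₀ (Real.exp_pos _) (by positivity), inv_div, ← sq_abs]
  linarith [abs_nonneg u]

lemma cosh_pi_mul_ne_zero (u : ℝ) : Complex.cosh (Real.pi * u) ≠ 0 := by
  exact_mod_cast (Real.cosh_pos (Real.pi * u)).ne'

lemma exp_two_mul_abs_le_norm_cosh (u : ℝ) :
    Real.exp (2 * |u|) ≤ ‖2 * Complex.cosh (Real.pi * u)‖ := by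
  have hcosh : ‖2 * Complex.cosh (Real.pi * u)‖ =
      Real.exp (Real.pi * |u|) + Real.exp (-(Real.pi * |u|)) := by
    rw [← Complex.ofReal_mul, ← Complex.ofReal_cosh, norm_mul, Complex.norm_real,
      Real.norm_of_nonneg (Real.cosh_pos _).le, ← Real.cosh_abs, Real.cosh_eq, abs_mul,
      abs_of_pos Real.pi_pos, Complex.norm_two]
    ring
  have hexp : Real.exp (2 * |u|) ≤ Real.exp (Real.pi * |u|) := by
    gcongr
    exact Real.two_le_pi
  rw [hcosh]
  exact hexp.trans (le_add_of_nonneg_right (Real.exp_nonneg _))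

lemma Tame.integrable_line {h : ℂ → ℂ} (hh : Tame h) (σ : ℝ) :
    Integrable fun u : ℝ => h (σ + u * I) / (2 * Complex.cosh (Real.pi * u)) := by
  obtain ⟨C, hC⟩ := hh.bound |σ|
  have hcont : Continuous fun u : ℝ => h (σ + u * I) / (2 * Complex.cosh (Real.pi * u)) :=
    (hh.differentiable.continuous.comp (by fun_prop)).div (by fun_prop) fun u =>
      mul_ne_zero two_ne_zero (cosh_pi_mul_ne_zero u)
  refine (integrable_exp_neg_abs.const_mul C).mono' hcont.aestronglyMeasurable
    (Eventually.of_forall fun u => ?_)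
  have hle : ‖h (σ + u * I)‖ ≤ C * Real.exp |u| := by simpa using hC (σ + u * I) (by simp)
  have hC₀ : 0 ≤ C := nonneg_of_mul_nonneg_left ((norm_nonneg _).trans hle) (Real.exp_pos _)
  have hcosh := exp_two_mul_abs_le_norm_cosh u
  rw [norm_div, div_le_iff₀ ((Real.exp_pos _).trans_le hcosh)]
  calc ‖h (σ + u * I)‖ ≤ C * Real.exp |u| := hle
    _ = C * Real.exp (-|u|) * Real.exp (2 * |u|) := by
      rw [mul_assoc, ← Real.exp_add]
      ring_nf
    _ ≤ _ := mul_le_mul_of_nonneg_left hcosh (by positivity)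

lemma Tame.lineIntegral_sub {h g : ℂ → ℂ} (hh : Tame h) (hg : Tame g) (σ : ℝ) :
    lineIntegral (fun z => h z - g z) σ = lineIntegral h σ - lineIntegral g σ := by
  simp only [lineIntegral, sub_div]
  exact integral_sub (hh.integrable_line σ) (hg.integrable_line σ)

lemma hasDerivAt_arctan_exp (u : ℝ) :
    HasDerivAt (fun u => Real.arctan (Real.exp u)) (1 / (2 * Real.cosh u)) u := by
  refine (Real.hasDerivAt_exp u).arctan.congr_deriv ?_
  rw [Real.cosh_eq, Real.exp_neg]
  have : Real.exp u ≠ 0 := (Real.exp_pos u).ne'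
  field_simp
  ring

lemma integrable_inv_two_cosh : Integrable fun u : ℝ => 1 / (2 * Real.cosh u) := by
  rw [← integrable_comp_mul_left_iff _ Real.pi_ne_zero]
  convert ((tame_const 1).integrable_line 0).re using 2 with u
  rw [← Complex.ofReal_mul, ← Complex.ofReal_cosh]
  norm_cast

lemma integral_inv_two_cosh : ∫ u : ℝ, 1 / (2 * Real.cosh u) = Real.pi / 2 := by
  have hbot : Tendsto (fun u => Real.arctan (Real.exp u)) atBot (𝓝 0) := by
    rw [← Real.arctan_zero]
    exact (Real.continuous_arctan.tendsto 0).comp Real.tendsto_exp_atBot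
  have htop : Tendsto (fun u => Real.arctan (Real.exp u)) atTop (𝓝 (Real.pi / 2)) :=
    (Real.tendsto_arctan_atTop.mono_right nhdsWithin_le_nhds).comp Real.tendsto_exp_atTop
  rw [integral_of_hasDerivAt_of_tendsto hasDerivAt_arctan_exp integrable_inv_two_cosh hbot htop,
    sub_zero]

lemma lineIntegral_const (d : ℂ) (σ : ℝ) : lineIntegral (fun _ => d) σ = d / 2 := by
  have hscale := Measure.integral_comp_mul_left (fun u => 1 / (2 * Real.cosh u)) Real.pi
  rw [integral_inv_two_cosh, abs_of_pos (inv_pos.2 Real.pi_pos), smul_eq_mul,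
    inv_mul_eq_div, div_div_cancel_left' Real.pi_ne_zero] at hscale
  have hcast : ∫ u : ℝ, (1 / (2 * Complex.cosh (Real.pi * u)) : ℂ) = 1 / 2 := by
    have := congrArg Complex.ofReal hscale
    rw [← integral_complex_ofReal] at this
    push_cast at this
    rw [this, one_div]
  calc lineIntegral (fun _ => d) σ = ∫ u : ℝ, d * (1 / (2 * Complex.cosh (Real.pi * u))) := by
        simp only [lineIntegral, mul_one_div]
    _ = d / 2 := by rw [integral_const_mul, hcast, mul_one_div]

lemma exp_abs_im_sub_le_norm_sin (w : ℂ) :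
    Real.exp |w.im| - Real.exp (-|w.im|) ≤ 2 * ‖Complex.sin w‖ := by
  have hsin : 2 * ‖Complex.sin w‖ = ‖Complex.exp (-w * I) - Complex.exp (w * I)‖ := by
    rw [← Complex.norm_two, ← norm_mul, Complex.two_sin, norm_mul, Complex.norm_I, mul_one]
  have hneg : ‖Complex.exp (-w * I)‖ = Real.exp w.im := by simp [Complex.norm_exp]
  have hpos : ‖Complex.exp (w * I)‖ = Real.exp (-w.im) := by simp [Complex.norm_exp]
  rw [hsin]
  rcases le_total 0 w.im with h | h
  · rw [abs_of_nonneg h, ← hneg, ← hpos]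
    exact norm_sub_norm_le _ _
  · rw [abs_of_nonpos h, neg_neg, ← hneg, ← hpos, norm_sub_rev]
    exact norm_sub_norm_le _ _

lemma exp_two_mul_abs_le_norm_sin (x : ℝ) {y : ℝ} (hy : 1 ≤ |y|) :
    Real.exp (2 * |y|) ≤ 4 * ‖Complex.sin (Real.pi * (x + y * I))‖ := by
  have him : |(Real.pi * (x + y * I) : ℂ).im| = Real.pi * |y| := by
    simp [abs_mul, abs_of_pos Real.pi_pos]
  have hsin := exp_abs_im_sub_le_norm_sin (Real.pi * (x + y * I))
  rw [him] at hsin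
  have hone : (1 : ℝ) ≤ Real.exp (2 * |y|) := Real.one_le_exp (by positivity)
  have htwo : 2 ≤ Real.exp ((Real.pi - 2) * |y|) := by
    nlinarith [Real.add_one_le_exp ((Real.pi - 2) * |y|), Real.pi_gt_three]
  have hsplit : Real.exp (Real.pi * |y|) = Real.exp (2 * |y|) * Real.exp ((Real.pi - 2) * |y|) := by
    rw [← Real.exp_add]
    ring_nf
  have hsmall : Real.exp (-(Real.pi * |y|)) ≤ 1 :=
    Real.exp_le_one_iff.2 (neg_nonpos.2 (by positivity))
  nlinarith

lemma sin_pi_mul_ne_zero {z : ℂ} (hz : ∀ n : ℤ, z ≠ n) : Complex.sin (Real.pi * z) ≠ 0 := by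
  rw [Complex.sin_ne_zero_iff]
  intro n hn
  rw [mul_comm] at hn
  exact hz n (mul_right_cancel₀ (Complex.ofReal_ne_zero.2 Real.pi_ne_zero) hn)

lemma Tame.exists_norm_div_sin_le {h : ℂ → ℂ} (hh : Tame h) (b : ℝ) :
    ∃ C : ℝ, ∀ x y : ℝ, |x| ≤ b → 1 ≤ |y| →
      ‖h (x + y * I) / Complex.sin (Real.pi * (x + y * I))‖ ≤ C * Real.exp (-|y|) := by
  obtain ⟨C, hC⟩ := hh.bound b
  refine ⟨4 * C, fun x y hx hy => ?_⟩
  have hle : ‖h (x + y * I)‖ ≤ C * Real.exp |y| := by simpa using hC (x + y * I) (by simpa using hx)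
  have hC₀ : 0 ≤ C := nonneg_of_mul_nonneg_left ((norm_nonneg _).trans hle) (Real.exp_pos _)
  have hsin := exp_two_mul_abs_le_norm_sin x hy
  have hpos : 0 < ‖Complex.sin (Real.pi * (x + y * I))‖ := by
    linarith [Real.exp_pos (2 * |y|)]
  rw [norm_div, div_le_iff₀ hpos]
  calc ‖h (x + y * I)‖ ≤ C * Real.exp |y| := hle
    _ = C * Real.exp (-|y|) * Real.exp (2 * |y|) := by
      rw [mul_assoc, ← Real.exp_add]
      ring_nf
    _ ≤ C * Real.exp (-|y|) * (4 * ‖Complex.sin (Real.pi * (x + y * I))‖) := by gcongr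
    _ = _ := by ring

lemma sin_pi_half_add (u : ℝ) :
    Complex.sin (Real.pi * (((1 / 2 : ℝ) : ℂ) + u * I)) = Complex.cosh (Real.pi * u) := by
  have harg : (Real.pi * (((1 / 2 : ℝ) : ℂ) + u * I) : ℂ) =
      Real.pi * u * I + Real.pi / 2 := by push_cast; ring
  rw [harg, Complex.sin_add_pi_div_two, Complex.cos_mul_I]

lemma sin_pi_neg_half_add (u : ℝ) :
    Complex.sin (Real.pi * (((-(1 / 2) : ℝ) : ℂ) + u * I)) = -Complex.cosh (Real.pi * u) := by
  have harg : (Real.pi * (((-(1 / 2) : ℝ) : ℂ) + u * I) : ℂ) =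
      Real.pi * u * I - Real.pi / 2 := by push_cast; ring
  rw [harg, Complex.sin_sub_pi_div_two, Complex.cos_mul_I]

lemma exists_differentiableOn_eq_div_sin {h : ℂ → ℂ} (hh : Differentiable ℂ h) (h₀ : h 0 = 0) :
    ∃ F : ℂ → ℂ, DifferentiableOn ℂ F (Complex.re ⁻¹' Set.Ioo (-1) 1) ∧
      ∀ z ≠ 0, F z = h z / Complex.sin (Real.pi * z) := by
  have hslope {f : ℂ → ℂ} (hf : Differentiable ℂ f) : Differentiable ℂ (dslope f 0) := by
    rw [← differentiableOn_univ, Complex.differentiableOn_dslope Filter.univ_mem]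
    exact hf.differentiableOn
  have hsin : Differentiable ℂ fun z : ℂ => Complex.sin (Real.pi * z) := by fun_prop
  have hderiv : HasDerivAt (fun z : ℂ => Complex.sin (Real.pi * z)) Real.pi 0 := by
    simpa using ((hasDerivAt_id (0 : ℂ)).const_mul (Real.pi : ℂ)).csin
  refine ⟨fun z => dslope h 0 z / dslope (fun z => Complex.sin (Real.pi * z)) 0 z,
    (hslope hh).differentiableOn.div (hslope hsin).differentiableOn fun z hz => ?_, fun z hz => ?_⟩
  · rcases eq_or_ne z 0 with rfl | hz₀
    · simp [dslope_same, hderiv.deriv]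
    · have hint (n : ℤ) : z ≠ n := by
        rintro rfl
        simp only [Set.mem_preimage, Complex.intCast_re, Set.mem_Ioo] at hz
        norm_cast at hz hz₀
        lia
      rw [dslope_of_ne _ hz₀, slope_def_field]
      simpa using ⟨sin_pi_mul_ne_zero hint, hz₀⟩
  · simp only [dslope_of_ne _ hz, slope_def_field, h₀, mul_zero, Complex.sin_zero, sub_zero]
    rw [div_div_div_cancel_right₀ hz]

lemma Tame.lineIntegral_half_of_apply_zero {h : ℂ → ℂ} (hh : Tame h) (h₀ : h 0 = 0) :
    lineIntegral h (1 / 2) + lineIntegral h (-(1 / 2)) = 0 := by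
  obtain ⟨F, hF, hFh⟩ := exists_differentiableOn_eq_div_sin hh.differentiable h₀
  have hright (y : ℝ) : F ((1 / 2 : ℝ) + y * I) =
      2 * (h ((1 / 2 : ℝ) + y * I) / (2 * Complex.cosh (Real.pi * y))) := by
    rw [hFh _ fun h => by simpa using congrArg Complex.re h, sin_pi_half_add]
    ring
  have hleft (y : ℝ) : F ((-(1 / 2) : ℝ) + y * I) =
      -2 * (h ((-(1 / 2) : ℝ) + y * I) / (2 * Complex.cosh (Real.pi * y))) := by
    rw [hFh _ fun h => by simpa using congrArg Complex.re h, sin_pi_neg_half_add]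
    ring
  have hstrip : Set.uIcc (-(1 / 2)) (1 / 2 : ℝ) ⊆ Set.Ioo (-1) 1 := by
    rw [Set.uIcc_of_le (by norm_num)]
    exact Set.Icc_subset_Ioo (by norm_num) (by norm_num)
  obtain ⟨C, hC⟩ := hh.exists_norm_div_sin_le 1
  have hdecay : Tendsto (fun y : ℝ => C * Real.exp (-|y|)) (cocompact ℝ) (𝓝 0) := by
    simpa using (Real.tendsto_exp_neg_atTop_nhds_zero.comp
      (tendsto_norm_cocompact_atTop (E := ℝ))).const_mul C
  have hshift := integral_vertical_line_eq (φ := fun y => C * Real.exp (-|y|))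
    (hF.mono (Set.preimage_mono hstrip))
    (by simpa only [hleft] using (hh.integrable_line _).const_mul (-2))
    (by simpa only [hright] using (hh.integrable_line _).const_mul 2) hdecay (by
      filter_upwards [(tendsto_norm_cocompact_atTop (E := ℝ)).eventually_ge_atTop 1]
        with y hy x hx
      rw [hFh _ fun h => by
        have him : y = 0 := by simpa using congrArg Complex.im h
        norm_num [him] at hy]
      exact hC x y (abs_le.2 ⟨(hstrip hx).1.le, (hstrip hx).2.le⟩) hy)
  simp only [hleft, hright, integral_const_mul] at hshift
  rw [lineIntegral, lineIntegral]
  linear_combination -hshift / 2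

lemma Tame.lineIntegral_half {h : ℂ → ℂ} (hh : Tame h) :
    lineIntegral h (1 / 2) + lineIntegral h (-(1 / 2)) = h 0 := by
  have hzero := (hh.sub (tame_const (h 0))).lineIntegral_half_of_apply_zero (sub_self _)
  simp only [hh.lineIntegral_sub (tame_const _), lineIntegral_const] at hzero
  linear_combination hzero

lemma Tame.lineIntegral_add_lineIntegral {h : ℂ → ℂ} (hh : Tame h) (m : ℝ) :
    lineIntegral h (m + 1 / 2) + lineIntegral h (m - 1 / 2) = h m := by
  have hshift := (hh.comp_add m).lineIntegral_half
  rwa [lineIntegral_comp_add, lineIntegral_comp_add, zero_add, add_comm (1 / 2) m,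
    neg_add_eq_sub] at hshift

end VerticalLines

section DualFamily

open Polynomial

lemma norm_pow_le_exp (k : ℕ) {b : ℝ} {z : ℂ} (hz : |z.re| ≤ b) :
    ‖z ^ k‖ ≤ k.factorial * Real.exp b * Real.exp |z.im| := by
  have hnorm : ‖z‖ ≤ b + |z.im| :=
    (Complex.norm_le_abs_re_add_abs_im z).trans (by linarith)
  have hpow := Real.pow_div_factorial_le_exp ‖z‖ (norm_nonneg z) k
  rw [div_le_iff₀ (by positivity)] at hpow
  rw [norm_pow, mul_assoc, ← Real.exp_add, mul_comm]
  exact hpow.trans (by gcongr)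

lemma exists_norm_eval_le_exp (p : ℂ[X]) (b : ℝ) :
    ∃ C : ℝ, ∀ z : ℂ, |z.re| ≤ b → ‖p.eval z‖ ≤ C * Real.exp |z.im| := by
  refine ⟨∑ k ∈ Finset.range (p.natDegree + 1), ‖p.coeff k‖ * (k.factorial * Real.exp b),
    fun z hz => ?_⟩
  rw [eval_eq_sum_range, Finset.sum_mul]
  refine (norm_sum_le _ _).trans (Finset.sum_le_sum fun k _ => ?_)
  rw [norm_mul, mul_assoc]
  exact mul_le_mul_of_nonneg_left (norm_pow_le_exp k hz) (norm_nonneg _)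

lemma tame_eval_mul_cpow (p : ℂ[X]) {c : ℝ} (hc : 0 < c) :
    Tame fun z => p.eval z * (c : ℂ) ^ (-z) where
  differentiable := p.differentiable.mul fun _ =>
    differentiableAt_id.neg.const_cpow (Or.inl (Complex.ofReal_ne_zero.2 hc.ne'))
  bound b := by
    obtain ⟨C, hC⟩ := exists_norm_eval_le_exp p b
    refine ⟨C * Real.exp (|Real.log c| * b), fun z hz => ?_⟩
    rw [norm_mul, Complex.norm_cpow_eq_rpow_re_of_pos hc, Real.rpow_def_of_pos hc, mul_right_comm]
    refine mul_le_mul (hC z hz) (Real.exp_le_exp.2 ?_) (Real.exp_nonneg _)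
      ((norm_nonneg _).trans (hC z hz))
    refine (le_abs_self _).trans ?_
    rw [abs_mul, Complex.neg_re, abs_neg]
    gcongr

lemma tame_poch_mul_eval (q : ℂ[X]) {c : ℝ} (hc : 0 < c) (n : ℕ) (r x : ℂ) :
    Tame fun v => poch (v + r) n / n.factorial * q.eval (x + v) * (c : ℂ) ^ (-v) := by
  convert (tame_eval_mul_cpow ((ascPochhammer ℂ n).comp (X + C r) * q.comp (C x + X)) hc).const_mul
    (n.factorial : ℂ)⁻¹ using 1
  ext v
  simp only [poch, eval_mul, eval_comp, eval_add, eval_X, eval_C]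
  ring

/-- The integrand of `inverseAvg`. -/
def inverseAvgIntegrand (c : ℝ) (q : ℂ[X]) (n : ℕ) (x : ℂ) : ℂ → ℂ := fun v =>
  poch (v + 1) n / n.factorial * q.eval (x + v) * (c : ℂ) ^ (-v)

lemma tame_inverseAvgIntegrand {c : ℝ} (hc : 0 < c) (q : ℂ[X]) (n : ℕ) (x : ℂ) :
    Tame (inverseAvgIntegrand c q n x) :=
  tame_poch_mul_eval q hc n 1 x

/-- The inverse of `n + 1` averaging steps applied to the polynomial `q`, up to a constant: for
`c = (1 - β) / β`, the functions `f n = inverseAvg c q n` satisfy `avg β (f 0) = (1 - β) • q` and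
`avg β (f (n + 1)) = -(1 - β) • f n`. -/
def inverseAvg (c : ℝ) (q : ℂ[X]) (n : ℕ) (x : ℤ) : ℂ :=
  lineIntegral (inverseAvgIntegrand c q n x) (-(n : ℝ) - 1 / 2)

lemma inverseAvg_eq (c : ℝ) (q : ℂ[X]) (n : ℕ) (x : ℤ) : inverseAvg c q n x =
    lineIntegral (fun v => poch (v + 1) n / n.factorial * q.eval (x + v) * (c : ℂ) ^ (-v))
      (-(n : ℝ) - 1 / 2) := rfl

lemma inverseAvg_add_one {c : ℝ} (hc : c ≠ 0) (q : ℂ[X]) (n : ℕ) (x : ℤ) :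
    inverseAvg c q n (x + 1) =
      c * lineIntegral (fun v => poch v n / n.factorial * q.eval (x + v) * (c : ℂ) ^ (-v))
        (-(n : ℝ) + 1 / 2) := by
  have hcpow (v : ℂ) : (c : ℂ) ^ (-v) = c * (c : ℂ) ^ (-(v + 1)) := by
    rw [neg_add', Complex.cpow_sub _ _ (Complex.ofReal_ne_zero.2 hc), Complex.cpow_one,
      mul_div_cancel₀ _ (Complex.ofReal_ne_zero.2 hc)]
  rw [(by ring : -(n : ℝ) + 1 / 2 = -(n : ℝ) - 1 / 2 + 1), ← lineIntegral_comp_add,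
    ← lineIntegral_const_mul, inverseAvg_eq]
  congr 1
  ext v
  rw [hcpow]
  push_cast
  rw [(by ring : (x + (v + 1) : ℂ) = x + 1 + v)]
  ring

lemma avg_inverseAvg_zero {β : ℂ} {c : ℝ} (hc : 0 < c) (hβ : β * c = 1 - β) (q : ℂ[X]) :
    avg β (inverseAvg c q 0) = (1 - β) • fun x : ℤ => q.eval (x : ℂ) := by
  ext x
  have hres := (tame_poch_mul_eval q hc 0 1 x).lineIntegral_add_lineIntegral 0
  simp only [poch, ascPochhammer_zero, eval_one, Complex.ofReal_zero, add_zero, neg_zero,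
    Complex.cpow_zero, Nat.factorial_zero, Nat.cast_one, div_one, one_mul, mul_one] at hres
  rw [avg_apply, inverseAvg_add_one hc.ne', ← mul_assoc, hβ, inverseAvg_eq,
    ← mul_add, Pi.smul_apply, smul_eq_mul, ← hres]
  simp [poch, add_comm]

lemma poch_div_factorial_sub (n : ℕ) (z : ℂ) :
    poch z (n + 1) / (n + 1).factorial - poch (z + 1) (n + 1) / (n + 1).factorial =
      -(poch (z + 1) n / n.factorial) := by
  have hleft : poch z (n + 1) = z * poch (z + 1) n := by
    simp [poch, ascPochhammer_succ_left]
  have hright : poch (z + 1) (n + 1) = poch (z + 1) n * (z + 1 + n) := by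
    simp [poch, ascPochhammer_succ_right]
  have hn : (n.factorial : ℂ) ≠ 0 := Nat.cast_ne_zero.2 n.factorial_ne_zero
  have hn' : (n + 1 : ℂ) ≠ 0 := Nat.cast_add_one_ne_zero n
  rw [hleft, hright, Nat.factorial_succ]
  push_cast
  field_simp
  ring

lemma avg_inverseAvg_succ {β : ℂ} {c : ℝ} (hc : 0 < c) (hβ : β * c = 1 - β) (q : ℂ[X]) (n : ℕ) :
    avg β (inverseAvg c q (n + 1)) = -(1 - β) • inverseAvg c q n := by
  ext x
  have hline (r : ℂ) := tame_poch_mul_eval q hc (n + 1) r x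
  have hres := (hline 1).lineIntegral_add_lineIntegral (-((n + 1 : ℕ) : ℝ))
  have hvanish : poch (((-((n + 1 : ℕ) : ℝ) : ℝ) : ℂ) + 1) (n + 1) = 0 := by
    simp [poch, ascPochhammer_succ_right]
  rw [hvanish, zero_div, zero_mul, zero_mul] at hres
  have hpascal : lineIntegral (fun v => poch v (n + 1) / (n + 1).factorial * q.eval (x + v) *
        (c : ℂ) ^ (-v)) (-((n + 1 : ℕ) : ℝ) + 1 / 2) -
      lineIntegral (fun v => poch (v + 1) (n + 1) / (n + 1).factorial * q.eval (x + v) *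
        (c : ℂ) ^ (-v)) (-((n + 1 : ℕ) : ℝ) + 1 / 2) = -inverseAvg c q n x := by
    rw [← Tame.lineIntegral_sub (by simpa using hline 0) (hline 1), inverseAvg_eq,
      ← neg_one_mul (lineIntegral _ _), ← lineIntegral_const_mul]
    congr 1
    · ext v
      linear_combination q.eval (x + v) * (c : ℂ) ^ (-v) * poch_div_factorial_sub n v
    · push_cast
      ring
  rw [avg_apply, inverseAvg_add_one hc.ne', ← mul_assoc, hβ, inverseAvg_eq,
    Pi.smul_apply, smul_eq_mul]
  linear_combination (1 - β) * (hpascal + hres)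

lemma exists_polynomial_inverseAvg {c : ℝ} (hc : 0 < c) {q : ℂ[X]} {N : ℕ} (hq : q.degree < N)
    (n : ℕ) : ∃ p : ℂ[X], p.degree < N ∧ ∀ x : ℤ, inverseAvg c q n x = p.eval (x : ℂ) := by
  let h (k : ℕ) : ℂ → ℂ := inverseAvgIntegrand c (hasseDeriv k q) n 0
  have hh (k : ℕ) : Tame (h k) := tame_inverseAvgIntegrand hc _ n 0
  have htaylor (x v : ℂ) :
      q.eval (x + v) = ∑ k : Fin N, (hasseDeriv k q).eval v * x ^ (k : ℕ) := by
    rw [← taylor_eval, eval_eq_sum, ← sum_fin (fun k d => d * x ^ k) (fun _ => zero_mul _)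
      ((degree_taylor q v).trans_lt hq)]
    simp only [taylor_coeff]
  refine ⟨∑ k : Fin N, C (lineIntegral (h k) (-(n : ℝ) - 1 / 2)) * X ^ (k : ℕ),
    degree_sum_fin_lt _, fun x => ?_⟩
  simp only [eval_finsetSum, eval_mul, eval_C, eval_pow, eval_X, lineIntegral, inverseAvg_eq,
        ← integral_mul_const]
  rw [← integral_finsetSum Finset.univ fun (k : Fin N) _ => ((hh k).integrable_line _).mul_const _]
  congr 1
  ext u
  rw [htaylor, Finset.mul_sum, Finset.sum_mul, Finset.sum_div]
  refine Finset.sum_congr rfl fun k _ => ?_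
  simp only [h, inverseAvgIntegrand, zero_add]
  ring

variable {N : ℕ}

/-- The Lagrange polynomial that is `1` at `a j` and `0` at the other entries of `a`. -/
def lagrange (a : Fin N → ℤ) (j : Fin N) : ℂ[X] :=
  Lagrange.basis Finset.univ (fun i => (a i : ℂ)) j

/-- The family dual to the Bernoulli weights started from `a`, obtained from the Lagrange
polynomials by inverting `t` averaging steps. -/
def dualFamily (β : ℝ) (a : Fin N → ℤ) : ℕ → Fin N → ℤ → ℂ
  | 0, j => fun x => (lagrange a j).eval (x : ℂ)
  | n + 1, j => ((-1) ^ n / (1 - β : ℂ) ^ (n + 1)) •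
      inverseAvg ((1 - β) / β) (lagrange a j) n

lemma degree_lagrange_lt {a : Fin N → ℤ} (ha : Function.Injective a) (j : Fin N) :
    (lagrange a j).degree < N := by
  rw [lagrange, Lagrange.degree_basis (v := fun i => (a i : ℂ))
    (Int.cast_injective.comp ha).injOn (Finset.mem_univ j), Finset.card_fin]
  exact_mod_cast Nat.sub_lt j.pos one_pos

lemma eval_lagrange {a : Fin N → ℤ} (ha : Function.Injective a) (i j : Fin N) :
    (lagrange a j).eval (a i : ℂ) = (1 : Matrix (Fin N) (Fin N) ℂ) i j := by
  rw [lagrange, Matrix.one_apply]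
  split_ifs with hij
  · rw [hij]
    exact Lagrange.eval_basis_self (v := fun i => (a i : ℂ)) (Int.cast_injective.comp ha).injOn
      (Finset.mem_univ j)
  · exact Lagrange.eval_basis_of_ne (v := fun i => (a i : ℂ)) (Ne.symm hij) (Finset.mem_univ i)

lemma isDualFamily_dualFamily {β : ℝ} (hβ₀ : 0 < β) (hβ₁ : β < 1) {a : Fin N → ℤ}
    (ha : Function.Injective a) : IsDualFamily (β : ℂ) a (dualFamily β a) := by
  have hc : 0 < (1 - β) / β := div_pos (sub_pos.2 hβ₁) hβ₀
  have hβc : (β : ℂ) * ((1 - β) / β : ℝ) = 1 - β := by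
    rw [← Complex.ofReal_mul, mul_div_cancel₀ _ hβ₀.ne']
    push_cast
    rfl
  have hβ : (1 - β : ℂ) ≠ 0 := by exact_mod_cast (sub_pos.2 hβ₁).ne'
  have hsucc (n : ℕ) (j : Fin N) : dualFamily β a (n + 1) j =
      ((-1) ^ n / (1 - β : ℂ) ^ (n + 1)) • inverseAvg ((1 - β) / β) (lagrange a j) n := rfl
  refine ⟨fun t j => ?_, eval_lagrange ha, fun t j => ?_⟩
  · cases t with
    | zero =>
      rw [hsucc, map_smul, avg_inverseAvg_zero hc hβc, smul_smul]
      simp [dualFamily, hβ]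
    | succ n =>
      rw [hsucc, map_smul, avg_inverseAvg_succ hc hβc, smul_smul, hsucc]
      congr 1
      field_simp
      ring
  · cases t with
    | zero => exact ⟨lagrange a j, degree_lagrange_lt ha j, fun _ => rfl⟩
    | succ n =>
      obtain ⟨p, hp, heval⟩ := exists_polynomial_inverseAvg hc (degree_lagrange_lt ha j) n
      refine ⟨((-1) ^ n / (1 - β : ℂ) ^ (n + 1)) • p, (degree_smul_le _ p).trans_lt hp, fun x => ?_⟩
      rw [hsucc, Pi.smul_apply, heval, eval_smul]

end DualFamily

section SinQuotient

/-- The coefficient of `X ^ d` in `(1 - X) ^ t`, for any integer `d`. -/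
def signedChoose (t : ℕ) (d : ℤ) : ℂ := if 0 ≤ d then (-1) ^ d * (t.choose d.toNat : ℂ) else 0

lemma signedChoose_zero (d : ℤ) : signedChoose 0 d = if d = 0 then 1 else 0 := by
  rcases lt_trichotomy d 0 with h | rfl | h
  · rw [signedChoose, if_neg h.not_ge, if_neg h.ne]
  · simp [signedChoose]
  · rw [signedChoose, if_pos h.le, if_neg h.ne', Nat.choose_eq_zero_of_lt (by omega)]
    simp

lemma signedChoose_succ (t : ℕ) (d : ℤ) :
    signedChoose (t + 1) d = signedChoose t d - signedChoose t (d - 1) := by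
  rcases lt_trichotomy d 0 with h | rfl | h
  · rw [signedChoose, signedChoose, signedChoose, if_neg h.not_ge, if_neg h.not_ge,
      if_neg (by omega), sub_zero]
  · simp [signedChoose]
  · obtain ⟨m, rfl⟩ : ∃ m : ℕ, d = m + 1 := ⟨(d - 1).toNat, by omega⟩
    have hm : ((m : ℤ) + 1).toNat = m + 1 := by omega
    simp only [signedChoose, hm, add_sub_cancel_right, Int.toNat_natCast, h.le,
      Int.natCast_nonneg, if_true, Nat.choose_succ_succ,
      zpow_add_one₀ (neg_ne_zero.2 (one_ne_zero (α := ℂ)))]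
    push_cast
    ring

lemma signedChoose_eq_zero {t : ℕ} {d : ℤ} (hd : d ∉ Set.Icc 0 (t : ℤ)) : signedChoose t d = 0 := by
  rw [signedChoose]
  split_ifs with h0
  · rw [Nat.choose_eq_zero_of_lt (by simp only [Set.mem_Icc] at hd; omega), Nat.cast_zero, mul_zero]
  · rfl

lemma sin_pi_mul_intCast (n : ℤ) : Complex.sin (Real.pi * n) = 0 := by
  rw [mul_comm, Complex.sin_int_mul_pi]

lemma cos_pi_mul_intCast (n : ℤ) : Complex.cos (Real.pi * n) = (-1) ^ n := by
  rw [← Complex.ofReal_intCast, ← Complex.ofReal_mul, ← Complex.ofReal_cos, mul_comm,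
    Real.cos_int_mul_pi]
  push_cast
  rfl

/-- The entire function `sin (π w) / (w - x)_{t + 1}`. -/
def sinQuotient : ℕ → ℤ → ℂ → ℂ
  | 0, x => dslope (fun w => Complex.sin (Real.pi * w)) x
  | t + 1, x => fun w => (sinQuotient t x w - sinQuotient t (x - 1) w) / (t + 1)

lemma differentiable_sinQuotient (t : ℕ) (x : ℤ) : Differentiable ℂ (sinQuotient t x) := by
  induction t generalizing x with
  | zero =>
    rw [← differentiableOn_univ]
    exact (Complex.differentiableOn_dslope Filter.univ_mem).2 (by fun_prop)
  | succ t ih => exact ((ih x).sub (ih (x - 1))).div_const _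

lemma poch_mul_sinQuotient (t : ℕ) (x : ℤ) (w : ℂ) :
    poch (w - x) (t + 1) * sinQuotient t x w = Complex.sin (Real.pi * w) := by
  induction t generalizing x with
  | zero =>
    have := sub_smul_dslope (fun w => Complex.sin (Real.pi * w)) (x : ℂ) w
    rw [sin_pi_mul_intCast, sub_zero, smul_eq_mul] at this
    simpa [poch, sinQuotient] using this
  | succ t ih =>
    have hleft : poch (w - x) (t + 2) = (w - x) * poch (w - (x - 1 : ℤ)) (t + 1) := by
      simp only [poch, ascPochhammer_succ_left _ (t + 1), Polynomial.eval_mul, Polynomial.eval_comp,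
        Polynomial.eval_X, Polynomial.eval_add, Polynomial.eval_one]
      push_cast
      ring_nf
    have hright : poch (w - x) (t + 2) = poch (w - x) (t + 1) * (w - x + (t + 1)) := by
      simp [poch, ascPochhammer_succ_right _ (t + 1)]
    have ht : (t + 1 : ℂ) ≠ 0 := Nat.cast_add_one_ne_zero t
    rw [sinQuotient, mul_div_assoc', div_eq_iff ht, mul_sub]
    nth_rw 1 [hright]
    rw [hleft]
    linear_combination (w - x + (t + 1)) * ih x - (w - x) * ih (x - 1)

lemma sinQuotient_intCast (t : ℕ) (x n : ℤ) :
    sinQuotient t x n = Real.pi * (-1) ^ n * signedChoose t (x - n) / t.factorial := by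
  induction t generalizing x with
  | zero =>
    rw [sinQuotient, signedChoose_zero]
    split_ifs with h
    · obtain rfl : x = n := sub_eq_zero.1 h
      have hderiv : HasDerivAt (fun w : ℂ => Complex.sin (Real.pi * w))
          (Complex.cos (Real.pi * x) * (Real.pi * 1)) (x : ℂ) :=
        ((hasDerivAt_id (x : ℂ)).const_mul (Real.pi : ℂ)).csin
      rw [dslope_same, hderiv.deriv, cos_pi_mul_intCast]
      simp [mul_comm]
    · have hne : (n : ℂ) ≠ x := fun hnx => h (by rw [Int.cast_injective hnx, sub_self])
      simp [dslope_of_ne _ hne, slope_def_field, sin_pi_mul_intCast]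
  | succ t ih =>
    simp only [sinQuotient]
    rw [ih, ih, signedChoose_succ, sub_right_comm x 1 n, Nat.factorial_succ]
    push_cast
    field_simp

end SinQuotient

section Residues

lemma sum_eval_basis_mul_inv_sub {F ι : Type*} [Field F] [DecidableEq ι] {s : Finset ι} {v : ι → F}
    (hv : Set.InjOn v s) {z w : F} (hz : ∀ i ∈ s, z ≠ v i) (hw : ∀ i ∈ s, w ≠ v i) (hwz : w ≠ z) :
    ∑ i ∈ s, (Lagrange.basis s v i).eval z * (w - v i)⁻¹ =
      (w - z)⁻¹ * (1 - ∏ i ∈ s, (z - v i) / (w - v i)) := by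
  rcases s.eq_empty_or_nonempty with rfl | hs
  · simp
  have hbarycentric {y : F} (hy : ∀ i ∈ s, y ≠ v i) :
      (∏ i ∈ s, (y - v i)) * ∑ i ∈ s, Lagrange.nodalWeight s v i * (y - v i)⁻¹ = 1 := by
    simpa only [Pi.one_apply, Lagrange.interpolate_one hv hs, Polynomial.eval_one, mul_one,
      Lagrange.eval_nodal] using (Lagrange.eval_interpolate_not_at_node 1 hy).symm
  have hwz := sub_ne_zero.2 hwz
  calc ∑ i ∈ s, (Lagrange.basis s v i).eval z * (w - v i)⁻¹
      = ∑ i ∈ s, (w - z)⁻¹ * (∏ i ∈ s, (z - v i)) * (Lagrange.nodalWeight s v i * (z - v i)⁻¹ -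
          Lagrange.nodalWeight s v i * (w - v i)⁻¹) := by
        refine Finset.sum_congr rfl fun i hi => ?_
        have hzi := sub_ne_zero.2 (hz i hi)
        have hwi := sub_ne_zero.2 (hw i hi)
        rw [Lagrange.eval_basis_not_at_node hi (hz i hi), Lagrange.eval_nodal]
        field_simp
        ring
    _ = (w - z)⁻¹ * (1 - ∏ i ∈ s, (z - v i) / (w - v i)) := by
        rw [← Finset.mul_sum, Finset.sum_sub_distrib, Finset.prod_div_distrib,
          eq_inv_of_mul_eq_one_right (hbarycentric hw), mul_assoc, mul_sub, hbarycentric hz,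
          div_eq_mul_inv]

lemma circleIntegral_inv_sub_mul {f : ℂ → ℂ} (hf : Differentiable ℂ f) {c p : ℂ} {r : ℝ}
    (hr : 0 ≤ r) (hp : p ∉ Metric.sphere c r) :
    ∮ w in C(c, r), (w - p)⁻¹ * f w =
      2 * Real.pi * Complex.I * (Metric.ball c r).indicator f p := by
  by_cases hpb : p ∈ Metric.ball c r
  · simpa [hpb] using Complex.circleIntegral_sub_inv_smul_of_differentiable_on_off_countable
      Set.countable_empty hpb hf.continuous.continuousOn fun w _ => hf w
  · have hne : ∀ w ∈ Metric.closedBall c r, w - p ≠ 0 := fun w hw h0 => by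
      rw [sub_eq_zero.1 h0, ← Metric.ball_union_sphere] at hw
      exact hw.elim hpb hp
    rw [Set.indicator_of_notMem hpb, mul_zero]
    refine Complex.circleIntegral_eq_zero_of_differentiable_on_off_countable hr
      Set.countable_empty ?_ fun w hw => ?_
    · exact ((by fun_prop : Continuous fun w => w - p).continuousOn.inv₀ hne).mul
        hf.continuous.continuousOn
    · exact (((differentiableAt_id.sub_const p).fun_inv
        (hne w (Metric.ball_subset_closedBall hw.1)))).fun_mul (hf w)

lemma circleIntegrable_inv_sub_mul {f : ℂ → ℂ} (hf : Continuous f) {c p : ℂ} {r : ℝ}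
    (hr : 0 ≤ r) (hp : p ∉ Metric.sphere c r) :
    CircleIntegrable (fun w => (w - p)⁻¹ * f w) c r := by
  refine ContinuousOn.circleIntegrable hr (((by fun_prop :
    Continuous fun w => w - p).continuousOn.inv₀ fun w hw h0 => hp ?_).mul hf.continuousOn)
  rwa [← sub_eq_zero.1 h0]

variable {N : ℕ} {β : ℝ} {a : Weyl N} {t₁ : ℕ} {x₁ : ℤ} {t₂ : ℕ} {x₂ : ℤ} {z : ℂ}

/-- The `w`-dependent part of the integrand once its poles at `z` and at the starting points `a`
have been split off; it is entire. -/
def entirePart (β : ℝ) (t : ℕ) (x : ℤ) (z w : ℂ) : ℂ :=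
  sinQuotient t x w * (((1 - β) / β : ℝ) : ℂ) ^ (w - z)

lemma ofReal_ratio_ne_zero (hβ₀ : 0 < β) (hβ₁ : β < 1) : (((1 - β) / β : ℝ) : ℂ) ≠ 0 :=
  Complex.ofReal_ne_zero.2 (div_pos (sub_pos.2 hβ₁) hβ₀).ne'

lemma differentiable_entirePart (hβ₀ : 0 < β) (hβ₁ : β < 1) (t : ℕ) (x : ℤ) (z : ℂ) :
    Differentiable ℂ (entirePart β t x z) :=
  (differentiable_sinQuotient t x).mul fun _ =>
    (differentiableAt_id.sub_const z).const_cpow (Or.inl (ofReal_ratio_ne_zero hβ₀ hβ₁))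

lemma integrand_eq_sub_sum (hz : ∀ n : ℤ, z ≠ n) {w : ℂ} (hw : ∀ n : ℤ, w ≠ n) (hwz : w ≠ z) :
    integrand β a t₁ x₁ t₂ x₂ z w =
      poch (z - x₂ + 1) (t₂ - 1) / Complex.sin (Real.pi * z) *
        ((w - z)⁻¹ * entirePart β t₁ x₁ z w -
          ∑ j, (lagrange a.1 j).eval z * ((w - a.1 j)⁻¹ * entirePart β t₁ x₁ z w)) := by
  have hpoch : poch (w - x₁) (t₁ + 1) ≠ 0 := by
    refine left_ne_zero_of_mul (b := sinQuotient t₁ x₁ w) ?_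
    rw [poch_mul_sinQuotient]
    exact sin_pi_mul_ne_zero hw
  have hfrac := sum_eval_basis_mul_inv_sub (s := Finset.univ) (v := fun j => (a.1 j : ℂ))
    (Int.cast_injective.comp a.2.injective).injOn (fun j _ => hz _) (fun j _ => hw _) hwz
  simp only [← mul_assoc, ← Finset.sum_mul, lagrange]
  rw [hfrac, integrand, ← poch_mul_sinQuotient t₁ x₁ w, entirePart]
  field_simp
  ring

lemma circleIntegrable_integrand_and_integral_eq (hβ₀ : 0 < β) (hβ₁ : β < 1) {c : ℂ} {r : ℝ}
    (hr : 0 ≤ r) (hz : ∀ n : ℤ, z ≠ n) (hzc : z ∉ Metric.closedBall c r)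
    (hn : ∀ n : ℤ, (n : ℂ) ∉ Metric.sphere c r) :
    CircleIntegrable (integrand β a t₁ x₁ t₂ x₂ z) c r ∧
      ∮ w in C(c, r), integrand β a t₁ x₁ t₂ x₂ z w =
        -(2 * Real.pi * Complex.I) * (poch (z - x₂ + 1) (t₂ - 1) / Complex.sin (Real.pi * z)) *
          ∑ j, (lagrange a.1 j).eval z *
            (Metric.ball c r).indicator (entirePart β t₁ x₁ z) (a.1 j) := by
  have hf := differentiable_entirePart hβ₀ hβ₁ t₁ x₁ z
  have hzs : z ∉ Metric.sphere c r := fun h => hzc (Metric.sphere_subset_closedBall h)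
  have hint {p : ℂ} (hp : p ∉ Metric.sphere c r) :=
    circleIntegrable_inv_sub_mul hf.continuous hr hp
  have hterm (j : Fin N) : CircleIntegrable (fun w => (lagrange a.1 j).eval z *
      ((w - a.1 j)⁻¹ * entirePart β t₁ x₁ z w)) c r :=
    (hint (hn _)).const_smul (a := (lagrange a.1 j).eval z)
  have hsum := CircleIntegrable.fun_sum Finset.univ fun j _ => hterm j
  have heq : Set.EqOn (integrand β a t₁ x₁ t₂ x₂ z) _ (Metric.sphere c r) := fun w hw =>
    integrand_eq_sub_sum hz (by rintro n rfl; exact hn n hw) (by rintro rfl; exact hzs hw)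
  refine ⟨?_, ?_⟩
  · refine (circleIntegrable_congr (heq.mono (by rw [abs_of_nonneg hr]))).2 ?_
    exact ((hint hzs).sub hsum).const_smul
  · rw [circleIntegral.integral_congr hr heq, circleIntegral.integral_const_mul,
      circleIntegral.integral_sub (hint hzs) hsum,
      circleIntegral.integral_fun_sum fun j _ => hterm j, circleIntegral_inv_sub_mul hf hr hzs,
      Set.indicator_of_notMem fun h => hzc (Metric.ball_subset_closedBall h)]
    simp only [circleIntegral.integral_const_mul, circleIntegral_inv_sub_mul hf hr (hn _),
      mul_left_comm _ (2 * Real.pi * Complex.I : ℂ), ← Finset.mul_sum]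
    ring

lemma linePoint_re (t : ℕ) (x : ℤ) (u : ℝ) : (linePoint t x u).re = x - t + 1 / 2 := by
  simp [linePoint]

lemma linePoint_ne_intCast (t : ℕ) (x : ℤ) (u : ℝ) (m : ℤ) : linePoint t x u ≠ m := by
  intro h
  have hre : (x : ℝ) - t + 1 / 2 = m := by simpa [linePoint_re] using congrArg Complex.re h
  have hdouble : (2 * x - 2 * t + 1 : ℝ) = 2 * m := by linarith
  have : 2 * x - 2 * t + 1 = 2 * m := by exact_mod_cast hdouble
  omega

lemma Circles.Admissible.linePoint_notMem_left {γ : Circles} (hγ : γ.Admissible a t₁ x₁ t₂ x₂)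
    (u : ℝ) : linePoint t₂ x₂ u ∉ Metric.closedBall γ.c₁ γ.r₁ := fun h =>
  (hγ.left _ h).ne (linePoint_re t₂ x₂ u)

lemma Circles.Admissible.linePoint_notMem_right {γ : Circles} (hγ : γ.Admissible a t₁ x₁ t₂ x₂)
    (u : ℝ) : linePoint t₂ x₂ u ∉ Metric.closedBall γ.c₂ γ.r₂ := fun h =>
  (hγ.right _ h).ne' (linePoint_re t₂ x₂ u)

lemma Circles.Admissible.indicator_add_indicator {γ : Circles}
    (hγ : γ.Admissible a t₁ x₁ t₂ x₂) {f : ℂ → ℂ} {s : ℤ} (hs : s ∉ wPoles a t₁ x₁ → f s = 0) :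
    (Metric.ball γ.c₁ γ.r₁).indicator f s + (Metric.ball γ.c₂ γ.r₂).indicator f s = f s := by
  by_cases hpole : s ∈ wPoles a t₁ x₁
  · have hdisj : (s : ℂ) ∈ Metric.ball γ.c₁ γ.r₁ → (s : ℂ) ∉ Metric.ball γ.c₂ γ.r₂ :=
      fun h₁ h₂ => lt_asymm (hγ.left _ (Metric.ball_subset_closedBall h₁))
        (hγ.right _ (Metric.ball_subset_closedBall h₂))
    rcases hγ.encircles s hpole with h | h
    · simp [h, hdisj h]
    · simp [h, mt hdisj (not_not_intro h)]
  · rw [Set.indicator_apply_eq_zero.2 fun _ => hs hpole,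
      Set.indicator_apply_eq_zero.2 fun _ => hs hpole, hs hpole, add_zero]

lemma entirePart_eq_zero_of_notMem_wPoles {j : Fin N} (hj : a.1 j ∉ wPoles a t₁ x₁) :
    entirePart β t₁ x₁ z (a.1 j) = 0 := by
  rw [entirePart, sinQuotient_intCast, signedChoose_eq_zero, mul_zero, zero_div, zero_mul]
  rintro ⟨h₁, h₂⟩
  exact hj ⟨⟨by omega, by omega⟩, j, rfl⟩

lemma Circles.Admissible.integral_integrand {γ : Circles} (hγ : γ.Admissible a t₁ x₁ t₂ x₂)
    (hβ₀ : 0 < β) (hβ₁ : β < 1) (u : ℝ) (hz : linePoint t₂ x₂ u = z) :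
    γ.integral (integrand β a t₁ x₁ t₂ x₂ z) =
      -(2 * Real.pi * Complex.I) * (poch (z - x₂ + 1) (t₂ - 1) / Complex.sin (Real.pi * z)) *
        ∑ j, (lagrange a.1 j).eval z * entirePart β t₁ x₁ z (a.1 j) := by
  subst hz
  have hne := linePoint_ne_intCast t₂ x₂ u
  rw [Circles.integral, (circleIntegrable_integrand_and_integral_eq hβ₀ hβ₁ hγ.nonneg₁ hne
    (hγ.linePoint_notMem_left u) hγ.avoids₁).2, (circleIntegrable_integrand_and_integral_eq hβ₀ hβ₁
    hγ.nonneg₂ hne (hγ.linePoint_notMem_right u) hγ.avoids₂).2, ← mul_add,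
    ← Finset.sum_add_distrib]
  simp only [← mul_add, hγ.indicator_add_indicator entirePart_eq_zero_of_notMem_wPoles]

end Residues

section Circles

lemma dist_intCast_ofReal (n : ℤ) (c : ℝ) : dist (n : ℂ) c = |n - c| := by
  rw [Complex.dist_eq, ← Complex.ofReal_intCast, ← Complex.ofReal_sub, Complex.norm_real,
    Real.norm_eq_abs]

/-- The center of the circle with diameter `[p - 1/4, q + 1/4]`, which encircles exactly the
integers from `p` to `q`. -/
def enclosingCenter (p q : ℤ) : ℝ := (p + q) / 2

/-- The radius of the circle with diameter `[p - 1/4, q + 1/4]`. -/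
def enclosingRadius (p q : ℤ) : ℝ := (q - p) / 2 + 1 / 4

lemma enclosingRadius_nonneg {p q : ℤ} (h : p ≤ q) : 0 ≤ enclosingRadius p q := by
  have : (p : ℝ) ≤ q := Int.cast_le.2 h
  rw [enclosingRadius]
  linarith

lemma intCast_notMem_sphere (p q n : ℤ) :
    (n : ℂ) ∉ Metric.sphere (enclosingCenter p q : ℂ) (enclosingRadius p q) := by
  rw [Metric.mem_sphere, dist_intCast_ofReal, enclosingCenter, enclosingRadius]
  intro h
  have hends : (4 * n : ℝ) = 4 * q + 1 ∨ (4 * n : ℝ) = 4 * p - 1 :=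
    (eq_or_eq_neg_of_abs_eq h).imp (fun h => by linarith) fun h => by linarith
  norm_cast at hends
  omega

lemma intCast_mem_ball {p q n : ℤ} (hn : n ∈ Set.Icc p q) :
    (n : ℂ) ∈ Metric.ball (enclosingCenter p q : ℂ) (enclosingRadius p q) := by
  have hp : (p : ℝ) ≤ n := Int.cast_le.2 hn.1
  have hq : (n : ℝ) ≤ q := Int.cast_le.2 hn.2
  rw [Metric.mem_ball, dist_intCast_ofReal, abs_lt, enclosingCenter, enclosingRadius]
  constructor <;> linarith

lemma re_mem_Icc_of_mem_closedBall {p q : ℤ} {w : ℂ}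
    (hw : w ∈ Metric.closedBall (enclosingCenter p q : ℂ) (enclosingRadius p q)) :
    w.re ∈ Set.Icc (p - 1 / 4 : ℝ) (q + 1 / 4) := by
  have hre : |w.re - enclosingCenter p q| ≤ enclosingRadius p q :=
    (Complex.abs_re_le_norm (w - enclosingCenter p q)).trans (mem_closedBall_iff_norm.1 hw)
  rw [abs_le, enclosingCenter, enclosingRadius] at hre
  constructor <;> linarith [hre.1, hre.2]

lemma exists_admissible {N : ℕ} (a : Weyl N) (t₁ : ℕ) (x₁ : ℤ) (t₂ : ℕ) (x₂ : ℤ) :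
    ∃ γ : Circles, γ.Admissible a t₁ x₁ t₂ x₂ := by
  obtain ⟨m, hm⟩ : ∃ m : ℤ, m = x₂ - t₂ := ⟨_, rfl⟩
  have hline : (x₂ : ℝ) - t₂ = m := by simp [hm]
  refine ⟨⟨enclosingCenter (min m (x₁ - t₁)) m, enclosingRadius (min m (x₁ - t₁)) m,
    enclosingCenter (m + 1) (max (m + 1) x₁), enclosingRadius (m + 1) (max (m + 1) x₁)⟩,
    enclosingRadius_nonneg (min_le_left _ _), enclosingRadius_nonneg (le_max_left _ _),
    fun w hw => ?_, fun w hw => ?_, intCast_notMem_sphere _ _, intCast_notMem_sphere _ _, ?_⟩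
  · linarith [(re_mem_Icc_of_mem_closedBall hw).2]
  · have := (re_mem_Icc_of_mem_closedBall hw).1
    push_cast at this
    linarith
  · rintro s ⟨⟨hs₁, hs₂⟩, -⟩
    rcases le_or_gt s m with h | h
    · exact Or.inl (intCast_mem_ball ⟨min_le_of_right_le hs₁, h⟩)
    · exact Or.inr (intCast_mem_ball ⟨h, le_max_of_le_right hs₂⟩)

end Circles

section Line

variable {N : ℕ} {β : ℝ} {a : Weyl N} {t₁ : ℕ} {x₁ : ℤ} {n : ℕ} {x₂ : ℤ} {γ : Circles}

lemma sin_linePoint (t : ℕ) (x : ℤ) (u : ℝ) :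
    Complex.sin (Real.pi * linePoint t x u) =
      (-1) ^ (x - (t : ℤ)) * Complex.cosh (Real.pi * u) := by
  have hshift : (Real.pi * linePoint t x u : ℂ) =
      Real.pi * (((1 / 2 : ℝ) : ℂ) + u * Complex.I) + Real.pi * ((x - t : ℤ) : ℂ) := by
    rw [linePoint]
    push_cast
    ring
  rw [hshift, Complex.sin_add, cos_pi_mul_intCast, sin_pi_mul_intCast, sin_pi_half_add]
  ring

/-- The residue of the integrand at the pole `w = a_j`, up to normalizing constants and the factors
which depend on `z`. -/
def lineCoeff (β : ℝ) (a : Weyl N) (t₁ : ℕ) (x₁ : ℤ) (n : ℕ) (x₂ : ℤ) (j : Fin N) : ℂ :=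
  (-1) ^ n * (-(((1 - β) / β : ℝ) : ℂ)) ^ (a.1 j - x₂) * signedChoose t₁ (x₁ - a.1 j)

lemma Circles.Admissible.integral_linePoint (hγ : γ.Admissible a t₁ x₁ (n + 1) x₂)
    (hβ₀ : 0 < β) (hβ₁ : β < 1) (u : ℝ) :
    γ.integral (integrand β a t₁ x₁ (n + 1) x₂ (linePoint (n + 1) x₂ u)) * Complex.I =
      (2 * Real.pi * Complex.I) ^ 2 * n.factorial / t₁.factorial *
        ∑ j, lineCoeff β a t₁ x₁ n x₂ j *
          (inverseAvgIntegrand ((1 - β) / β) (lagrange a.1 j) n x₂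
            (((-(n : ℝ) - 1 / 2 : ℝ) : ℂ) + u * Complex.I) /
              (2 * Complex.cosh (Real.pi * u))) := by
  set v : ℂ := ((-(n : ℝ) - 1 / 2 : ℝ) : ℂ) + u * Complex.I with hv
  have hc := ofReal_ratio_ne_zero hβ₀ hβ₁
  have hline : linePoint (n + 1) x₂ u = x₂ + v := by
    rw [hv, linePoint]
    push_cast
    ring
  have hpow (j : Fin N) : (((1 - β) / β : ℝ) : ℂ) ^ ((a.1 j : ℂ) - (x₂ + v)) =
      (((1 - β) / β : ℝ) : ℂ) ^ (a.1 j - x₂) * (((1 - β) / β : ℝ) : ℂ) ^ (-v) := by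
    rw [← Complex.cpow_intCast, ← Complex.cpow_add _ _ hc]
    push_cast
    ring_nf
  rw [hγ.integral_integrand hβ₀ hβ₁ u rfl, sin_linePoint, hline, Nat.add_sub_cancel,
    (by ring : (x₂ : ℂ) + v - x₂ + 1 = v + 1), Finset.mul_sum, Finset.mul_sum, Finset.sum_mul]
  refine Finset.sum_congr rfl fun j _ => ?_
  have hcosh := cosh_pi_mul_ne_zero u
  have hneg : (-1 : ℂ) ≠ 0 := neg_ne_zero.2 one_ne_zero
  have hsign : (-1 : ℂ) ^ a.1 j =
      -((-1) ^ (x₂ - ((n + 1 : ℕ) : ℤ)) * ((-1) ^ n * (-1) ^ (a.1 j - x₂))) := by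
    calc (-1 : ℂ) ^ a.1 j = (-1) ^ (x₂ - ((n + 1 : ℕ) : ℤ) + (n + (a.1 j - x₂)) + 1) := by
          congr 1
          omega
      _ = _ := by
          rw [zpow_add_one₀ hneg, zpow_add₀ hneg, zpow_add₀ hneg, zpow_natCast, mul_neg_one]
  have hzpow := zpow_ne_zero (x₂ - ((n + 1 : ℕ) : ℤ)) hneg
  have hn : (n.factorial : ℂ) ≠ 0 := Nat.cast_ne_zero.2 n.factorial_ne_zero
  rw [entirePart, sinQuotient_intCast, hpow, lineCoeff, hsign,
    neg_eq_neg_one_mul (((1 - β) / β : ℝ) : ℂ), mul_zpow,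
    inverseAvgIntegrand]
  field_simp

lemma Circles.Admissible.converges (hγ : γ.Admissible a t₁ x₁ (n + 1) x₂)
    (hβ₀ : 0 < β) (hβ₁ : β < 1) : Converges β a γ t₁ x₁ (n + 1) x₂ := by
  have hc : 0 < (1 - β) / β := div_pos (sub_pos.2 hβ₁) hβ₀
  refine ⟨fun u => ⟨?_, ?_⟩, (integrable_mul_const_iff Complex.I_ne_zero.isUnit _).1 ?_⟩
  · exact (circleIntegrable_integrand_and_integral_eq hβ₀ hβ₁ hγ.nonneg₁
      (linePoint_ne_intCast _ _ u) (hγ.linePoint_notMem_left u) hγ.avoids₁).1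
  · exact (circleIntegrable_integrand_and_integral_eq hβ₀ hβ₁ hγ.nonneg₂
      (linePoint_ne_intCast _ _ u) (hγ.linePoint_notMem_right u) hγ.avoids₂).1
  · simp only [hγ.integral_linePoint hβ₀ hβ₁]
    exact (integrable_finsetSum _ fun j _ => ((tame_inverseAvgIntegrand hc (lagrange a.1 j) n
      x₂).integrable_line _).const_mul _).const_mul _

lemma Circles.Admissible.integral_line (hγ : γ.Admissible a t₁ x₁ (n + 1) x₂)
    (hβ₀ : 0 < β) (hβ₁ : β < 1) :
    (t₁.factorial : ℂ) / n.factorial * (1 / (2 * Real.pi * Complex.I) ^ 2) *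
        ∫ u : ℝ, γ.integral (integrand β a t₁ x₁ (n + 1) x₂ (linePoint (n + 1) x₂ u)) * Complex.I =
      ∑ j, lineCoeff β a t₁ x₁ n x₂ j * inverseAvg ((1 - β) / β) (lagrange a.1 j) n x₂ := by
  have hc : 0 < (1 - β) / β := div_pos (sub_pos.2 hβ₁) hβ₀
  simp only [hγ.integral_linePoint hβ₀ hβ₁]
  rw [integral_const_mul, integral_finsetSum _ fun j _ => ((tame_inverseAvgIntegrand hc
    (lagrange a.1 j) n x₂).integrable_line _).const_mul _]
  simp only [integral_const_mul]
  have hn : (n.factorial : ℂ) ≠ 0 := Nat.cast_ne_zero.2 n.factorial_ne_zero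
  have ht : (t₁.factorial : ℂ) ≠ 0 := Nat.cast_ne_zero.2 t₁.factorial_ne_zero
  have hconst : (t₁.factorial : ℂ) / n.factorial * (1 / (2 * Real.pi * Complex.I) ^ 2) *
      ((2 * Real.pi * Complex.I) ^ 2 * n.factorial / t₁.factorial) = 1 := by
    have := Complex.two_pi_I_ne_zero
    field_simp
  rw [← mul_assoc, hconst, one_mul]
  rfl

end Line

section Gauge

variable {N : ℕ} {β : ℝ} {a : Weyl N}

/-- The factor which conjugates `preKernel` into `kernel`. -/
def gauge (β : ℝ) (t x : ℤ) : ℂ := (-(((1 - β) / β : ℝ) : ℂ)) ^ x / (1 - β : ℂ) ^ t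

lemma one_sub_ofReal_ne_zero (hβ₁ : β < 1) : (1 - β : ℂ) ≠ 0 :=
  sub_ne_zero.2 (Complex.ofReal_ne_one.2 hβ₁.ne).symm

lemma gauge_ne_zero (hβ₀ : 0 < β) (hβ₁ : β < 1) (t x : ℤ) : gauge β t x ≠ 0 :=
  div_ne_zero (zpow_ne_zero _ (neg_ne_zero.2 (ofReal_ratio_ne_zero hβ₀ hβ₁)))
    (zpow_ne_zero _ (one_sub_ofReal_ne_zero hβ₁))

lemma gauge_sub (hβ₀ : 0 < β) (hβ₁ : β < 1) (t t' x x' : ℤ) :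
    gauge β (t - t') (x - x') = gauge β t x * (gauge β t' x')⁻¹ := by
  rw [gauge, gauge, gauge, zpow_sub₀ (neg_ne_zero.2 (ofReal_ratio_ne_zero hβ₀ hβ₁)),
    zpow_sub₀ (one_sub_ofReal_ne_zero hβ₁), div_div_div_eq, inv_div, div_mul_div_comm]
  congr 1
  ring

lemma gauge_mul_bernoulliWeight (hβ₀ : 0 < β) (hβ₁ : β < 1) (t : ℕ) (d : ℤ) :
    gauge β t d * bernoulliWeight (β : ℂ) t d = signedChoose t d := by
  induction t generalizing d with
  | zero =>
    rw [bernoulliWeight, signedChoose_zero]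
    split_ifs with h <;> simp [h, gauge]
  | succ t ih =>
    have hβ : (β : ℂ) ≠ 0 := Complex.ofReal_ne_zero.2 hβ₀.ne'
    have hb := one_sub_ofReal_ne_zero hβ₁
    have hstay : gauge β (t + 1 : ℕ) d * (1 - β) = gauge β t d := by
      rw [gauge, gauge, Nat.cast_succ, zpow_add_one₀ hb]
      field_simp
    have hjump : gauge β (t + 1 : ℕ) d * β = -gauge β t (d - 1) := by
      rw [gauge, gauge, Nat.cast_succ, zpow_add_one₀ hb,
        zpow_sub_one₀ (neg_ne_zero.2 (ofReal_ratio_ne_zero hβ₀ hβ₁))]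
      push_cast
      field_simp
    rw [bernoulliWeight, signedChoose_succ, ← ih, ← ih]
    linear_combination bernoulliWeight (β : ℂ) t d * hstay +
      bernoulliWeight (β : ℂ) t (d - 1) * hjump

lemma det_diagonal_conj {K ι : Type*} [Field K] [Fintype ι] [DecidableEq ι] {g : ι → K}
    (hg : ∀ i, g i ≠ 0) (M : Matrix ι ι K) :
    (Matrix.of fun i j => g i * M i j * (g j)⁻¹).det = M.det := by
  have hconj : (Matrix.of fun i j => g i * M i j * (g j)⁻¹) =
      Matrix.diagonal g * M * Matrix.diagonal fun j => (g j)⁻¹ := by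
    ext i j
    simp
  simp [hconj, Matrix.det_mul, mul_right_comm _ M.det,
    mul_inv_cancel₀ (Finset.prod_ne_zero_iff.2 fun i _ => hg i)]

/-- The correlation kernel at all pairs of times, including those with `t₂ = 0`. -/
def walkKernel (β : ℝ) (a : Weyl N) (t₁ : ℕ) (x₁ : ℤ) (t₂ : ℕ) (x₂ : ℤ) : ℂ :=
  gauge β t₁ x₁ * preKernel (β : ℂ) a.1 (dualFamily β a.1) t₁ x₁ t₂ x₂ * (gauge β t₂ x₂)⁻¹

lemma IsWalk.isDeterminantal_walkKernel {Ω : Type*} [MeasurableSpace Ω] {P : Measure Ω}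
    [IsProbabilityMeasure P] {X : ℕ → Ω → Weyl N} (hX : IsWalk β a P X)
    (hβ₀ : 0 < β) (hβ₁ : β < 1) : IsDeterminantal P X (walkKernel β a) := by
  intro k t y hty
  rw [hX.isDeterminantal_preKernel (isDualFamily_dualFamily hβ₀ hβ₁ a.2.injective) k t y hty]
  exact (det_diagonal_conj (fun i => gauge_ne_zero hβ₀ hβ₁ (t i) (y i)) (Matrix.of fun i j =>
    preKernel (β : ℂ) a.1 (dualFamily β a.1) (t i) (y i) (t j) (y j))).symm

lemma gauge_mul_weight_mul_dualFamily (hβ₀ : 0 < β) (hβ₁ : β < 1) (t₁ : ℕ) (x₁ : ℤ) (n : ℕ)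
    (x₂ : ℤ) (j : Fin N) :
    gauge β t₁ x₁ * (bernoulliWeight (β : ℂ) t₁ (x₁ - a.1 j) * dualFamily β a.1 (n + 1) j x₂) *
        (gauge β (n + 1 : ℕ) x₂)⁻¹ =
      lineCoeff β a t₁ x₁ n x₂ j * inverseAvg ((1 - β) / β) (lagrange a.1 j) n x₂ := by
  have hb := one_sub_ofReal_ne_zero hβ₁
  have hsplit : gauge β t₁ x₁ * (gauge β (n + 1 : ℕ) x₂)⁻¹ =
      gauge β t₁ (x₁ - a.1 j) * ((-(((1 - β) / β : ℝ) : ℂ)) ^ (a.1 j - x₂) *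
        (1 - β : ℂ) ^ (n + 1)) := by
    have hc := neg_ne_zero.2 (ofReal_ratio_ne_zero hβ₀ hβ₁)
    have hcj := zpow_ne_zero (a.1 j) hc
    have hcx := zpow_ne_zero x₂ hc
    rw [gauge, gauge, gauge, zpow_sub₀ hc, zpow_sub₀ hc, zpow_natCast, zpow_natCast]
    field_simp
  rw [lineCoeff, ← gauge_mul_bernoulliWeight hβ₀ hβ₁, dualFamily, Pi.smul_apply, smul_eq_mul,
    mul_right_comm, hsplit]
  field_simp

lemma Circles.Admissible.walkKernel_eq_kernel {t₁ : ℕ} {x₁ : ℤ} {n : ℕ} {x₂ : ℤ} {γ : Circles}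
    (hγ : γ.Admissible a t₁ x₁ (n + 1) x₂) (hβ₀ : 0 < β) (hβ₁ : β < 1) :
    walkKernel β a t₁ x₁ (n + 1) x₂ = kernel β a γ t₁ x₁ (n + 1) x₂ := by
  rw [walkKernel, kernel, preKernel, Nat.add_sub_cancel, hγ.integral_line hβ₀ hβ₁, mul_sub, sub_mul,
    Finset.mul_sum, Finset.sum_mul, sub_eq_neg_add]
  simp only [gauge_mul_weight_mul_dualFamily hβ₀ hβ₁]
  congr 1
  by_cases ht : n + 1 < t₁
  · rw [if_pos ht, mul_right_comm, ← gauge_sub hβ₀ hβ₁, ← Nat.cast_sub ht.le,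
      gauge_mul_bernoulliWeight hβ₀ hβ₁, signedChoose]
    simp only [sub_nonneg, ht, and_true]
    split_ifs
    · rw [zpow_add_one₀ (neg_ne_zero.2 one_ne_zero)]
      ring
    · exact neg_zero
  · rw [if_neg ht, if_neg fun h => ht h.2, mul_zero, zero_mul, neg_zero]

end Gauge

end

end NoncollidingBernoulli

open NoncollidingBernoulli in
theorem theorem2p1 {N : ℕ} (β : ℝ) (hβ₀ : 0 < β) (hβ₁ : β < 1) (a : Weyl N)
    {Ω : Type*} [MeasurableSpace Ω] (P : MeasureTheory.Measure Ω)
    [MeasureTheory.IsProbabilityMeasure P] (X : ℕ → Ω → Weyl N) (hX : IsWalk β a P X) :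
    ∃ K : ℕ → ℤ → ℕ → ℤ → ℂ,
      IsDeterminantal P X K ∧
      ∀ (t₁ t₂ : ℕ) (x₁ x₂ : ℤ), 1 ≤ t₁ → 1 ≤ t₂ →
        (∃ γ : Circles, γ.Admissible a t₁ x₁ t₂ x₂) ∧
        ∀ γ : Circles, γ.Admissible a t₁ x₁ t₂ x₂ →
          Converges β a γ t₁ x₁ t₂ x₂ ∧
          K t₁ x₁ t₂ x₂ = kernel β a γ t₁ x₁ t₂ x₂ := by
  refine ⟨walkKernel β a, hX.isDeterminantal_walkKernel hβ₀ hβ₁, fun t₁ t₂ x₁ x₂ _ ht₂ => ?_⟩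
  obtain ⟨n, rfl⟩ : ∃ n, t₂ = n + 1 := ⟨t₂ - 1, by omega⟩
  exact ⟨exists_admissible a t₁ x₁ (n + 1) x₂, fun γ hγ =>
    ⟨hγ.converges hβ₀ hβ₁, hγ.walkKernel_eq_kernel hβ₀ hβ₁⟩⟩
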